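/- Let $n\ge 1$. Let $(\mathbf R_{>0})^n$ act on itself by componentwise multiplication $*$, and let $U$ be a subgroup of $\{x\in(\mathbf R_{>0})^n : x_1x_2\cdots x_n=1\}$ that is discrete and free of rank $n-1$, with an ordered $\mathbf Z$-basis $u_1,\dots,u_{n-1}$; write $u_{ij}$ for the $j$th coordinate of $u_i$. Assume that $e_n=(0,\dots,0,1)$ does not lie in the $\mathbf R$-linear span of any $n-1$ elements of $U$. For linearly independent $v_1,\dots,v_r\in\mathbf R^n$ ($r\ge 0$), the open cone they generate is $C(v_1,\dots,v_r)=\mathbf R_{>0}v_1+\cdots+\mathbf R_{>0}v_r$ (equal to $\{0\}$ if $r=0$). For $v_1,\dots,v_n\in\mathbf R^n$ let $c_{e_n}(v_1,\dots,v_n):\mathbf R^n\to\{0,1\}$ be the function $$c_{e_n}(v_1,\dots,v_n)(w)=\lim_{\epsilon\to0^+}\mathbf 1_{C(v_1,\dots,v_n)}(w+\epsilon e_n)$$ if the $v_i$ are linearly independent, and $0$ otherwise. Let $C_{e_n}(v_1,\dots,v_n)$ be the set with characteristic function $c_{e_n}(v_1,\dots,v_n)$; it is a disjoint union of faces $C(v_i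 : i\in I)$, $I\subseteq\{1,\dots,n\}$, and is regarded as the formal sum of these open cones. For $\sigma\in S_{n-1}$ put $$v_{i,\sigma}=u_{\sigma(1)}*\cdots* u_{\sigma(i-1)}\quad(1\le i\le n),\qquad v_{1,\sigma}=(1,\dots,1),$$ $$w_\sigma=(-1)^{n-1}\,\operatorname{sign}\det(\log u_{ij})_{i,j=1}^{n-1}\cdot\operatorname{sign}(\sigma)\cdot\operatorname{sign}\det(v_{i,\sigma})_{i=1}^{n}\in\{0,\pm1\}.$$ Then the formal linear combination of open cones $\sum_{\sigma\in S_{n-1}} w_\sigma\, C_{e_n}(v_{1,\sigma},\dots,v_{n,\sigma})$ is a signed fundamental domain for the action of $U$ on $(\mathbf R_{>0})^n$. Here a formal $\mathbf Z$-linear combination $\sum_i a_iC_i$ of open cones is called a signed fundamental domain if for every $x\in(\mathbf R_{>0})^n$ the sum $\sum_{u\in U}\sum_i a_i\mathbf 1_{C_i}(u*x)$ has only finitely many nonzero terms (indexed by $u\in U$) and equals $1$. In particular, for every $x\in(\mathbf R_{>0})^n$, $$\sum_{u\in U}\ \sum_{\sigma\in S_{n-1}} w_\sigma\, c_{e_n}(v_{1,\sigma},\dots,v_{n,\sigma})(u*x)=1,$$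 where only finitely many $u\in U$ contribute a nonzero term. -/

import Mathlib

open scoped Topology

noncomputable section

/-- The open cone `C(v) = ∑ i, ℝ_{>0} v i` generated by a finite family of vectors;
it is `{0}` for the empty family. -/
def openCone {ι E : Type*} [Fintype ι] [AddCommGroup E] [Module ℝ E] (v : ι → E) : Set E :=
  {w | ∃ c : ι → ℝ, (∀ i, 0 < c i) ∧ w = ∑ i, c i • v i}

/-- `S` is the open cone generated by finitely many (possibly zero) linearly independent vectors. -/
def IsOpenCone {E : Type*} [AddCommGroup E] [Module ℝ E] (S : Set E) : Prop :=
  ∃ (r : ℕ) (v : Fin r → E), LinearIndependent ℝ v ∧ S = openCone v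

/-- The set of all open cones of `E`. -/
abbrev OpenCone (E : Type*) [AddCommGroup E] [Module ℝ E] : Type _ :=
  {S : Set E // IsOpenCone S}

/-- Formal `ℤ`-linear combinations `∑ a_i C_i` of open cones. -/
abbrev FormalConeSum (E : Type*) [AddCommGroup E] [Module ℝ E] : Type _ :=
  OpenCone E →₀ ℤ

/-- The characteristic function `∑ a_i 1_{C_i}` of a formal linear combination of open cones. -/
def FormalConeSum.charFun {E : Type*} [AddCommGroup E] [Module ℝ E]
    (D : FormalConeSum E) (w : E) : ℤ :=
  D.sum fun C a => a * C.1.indicator (fun _ => (1 : ℤ)) w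

/-- The set `C_Q(v)`: for linearly independent `v`, the points `w` such that `w + ε Q` lies in the
open cone `C(v)` for all sufficiently small `ε > 0`; empty for linearly dependent `v`. -/
def perturbedConeSet {ι E : Type*} [Fintype ι] [AddCommGroup E] [Module ℝ E]
    (Q : E) (v : ι → E) : Set E :=
  {w | LinearIndependent ℝ v ∧ ∀ᶠ ε : ℝ in 𝓝[>] 0, w + ε • Q ∈ openCone v}

/-- The function `c_Q(v)`, the characteristic function of `C_Q(v)`. For linearly independent `v`,
it is the one-sided limit of `1_{C(v)}(w + ε Q)` as `ε → 0⁺`, see `tendsto_perturbedConeFun`. -/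
def perturbedConeFun {ι E : Type*} [Fintype ι] [AddCommGroup E] [Module ℝ E]
    (Q : E) (v : ι → E) (w : E) : ℤ :=
  (perturbedConeSet Q v).indicator (fun _ => (1 : ℤ)) w

theorem tendsto_perturbedConeFun {ι E : Type*} [Fintype ι] [AddCommGroup E] [Module ℝ E]
    (Q : E) (v : ι → E) (hv : LinearIndependent ℝ v) (w : E) :
    Filter.Tendsto (fun ε : ℝ => (openCone v).indicator (fun _ => (1 : ℤ)) (w + ε • Q))
      (𝓝[>] 0) (𝓝 (perturbedConeFun Q v w)) := by
  by_cases h : ∀ᶠ ε : ℝ in 𝓝[>] 0, w + ε • Q ∈ openCone v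
  · have hw : w ∈ perturbedConeSet Q v := ⟨hv, h⟩
    rw [perturbedConeFun, Set.indicator_of_mem hw]
    refine tendsto_const_nhds.congr' ?_
    filter_upwards [h] with ε hε
    rw [Set.indicator_of_mem hε]
  · have hw : w ∉ perturbedConeSet Q v := fun hw => h hw.2
    rw [perturbedConeFun, Set.indicator_of_notMem hw]
    have h' : ∀ᶠ ε : ℝ in 𝓝[>] 0, w + ε • Q ∉ openCone v := by
      by_contra hc
      have hf : ∃ᶠ ε : ℝ in 𝓝[>] 0, w + ε • Q ∈ openCone v := by
        exact fun h0 => hc h0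
      obtain ⟨s, ⟨c, hc0, hcs⟩, hs⟩ := (hf.and_eventually self_mem_nhdsWithin).exists
      apply h
      filter_upwards [Ioo_mem_nhdsGT hs] with ε hε
      obtain ⟨t, ⟨d, hd0, hdt⟩, ht⟩ := (hf.and_eventually (Ioo_mem_nhdsGT hε.1)).exists
      have hst : 0 < s - t := by linarith [ht.2, hε.2]
      refine ⟨fun i => ((s - ε) / (s - t)) * d i + ((ε - t) / (s - t)) * c i, fun i => ?_, ?_⟩
      · have h1 : 0 < (s - ε) / (s - t) := div_pos (by linarith [hε.2]) hst
        have h2 : 0 < (ε - t) / (s - t) := div_pos (by linarith [ht.2]) hst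
        have := mul_pos h1 (hd0 i)
        have := mul_pos h2 (hc0 i)
        linarith
      · simp only [add_smul, mul_smul, Finset.sum_add_distrib, ← Finset.smul_sum]
        rw [← hdt, ← hcs]
        have e1 : (s - ε) / (s - t) + (ε - t) / (s - t) = 1 := by field_simp; ring
        have e2 : (s - ε) / (s - t) * t + (ε - t) / (s - t) * s = ε := by field_simp; ring
        rw [smul_add, smul_add, smul_smul, smul_smul, add_add_add_comm, ← add_smul, ← add_smul,
          e1, e2, one_smul]
    refine tendsto_const_nhds.congr' ?_
    filter_upwards [h'] with ε hε
    rw [Set.indicator_of_notMem hε]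

theorem isOpenCone_openCone {ι E : Type*} [Fintype ι] [AddCommGroup E] [Module ℝ E]
    (v : ι → E) (hv : LinearIndependent ℝ v) : IsOpenCone (openCone v) := by
  let e := (Fintype.equivFin ι).symm
  refine ⟨Fintype.card ι, v ∘ e, hv.comp _ e.injective, ?_⟩
  ext w
  constructor
  · rintro ⟨c, hc, rfl⟩
    exact ⟨c ∘ e, fun i => hc _, (e.sum_comp fun i => c i • v i).symm⟩
  · rintro ⟨c, hc, rfl⟩
    refine ⟨c ∘ e.symm, fun i => hc _, ?_⟩
    rw [← e.sum_comp]
    simp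

/-- The face `C(v i : i ∈ I)` of the open cone on linearly independent vectors `v`. -/
def coneFace {ι E : Type*} [AddCommGroup E] [Module ℝ E]
    (v : ι → E) (hv : LinearIndependent ℝ v) (I : Finset ι) : OpenCone E :=
  ⟨openCone fun i : I => v i, isOpenCone_openCone _ (hv.comp _ Subtype.val_injective)⟩

open Classical in
/-- `C_Q(v)` as a formal sum of open cones: the sum of those faces of `C(v)` (of all dimensions,
including `0` and the open cone itself) which are contained in the set `C_Q(v)`; zero for linearly
dependent `v`. -/
def perturbedCone {ι E : Type*} [Fintype ι] [AddCommGroup E] [Module ℝ E]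
    (Q : E) (v : ι → E) : FormalConeSum E :=
  if hv : LinearIndependent ℝ v then
    ∑ I : Finset ι with (coneFace v hv I).1 ⊆ perturbedConeSet Q v,
      Finsupp.single (coneFace v hv I) 1
  else 0

/-- The positive orthant `(ℝ_{>0})^n`, a topological group under componentwise multiplication. -/
abbrev PosOrthant (n : ℕ) : Type := Fin n → {x : ℝ // 0 < x}

/-- The inclusion `(ℝ_{>0})^n ⊆ ℝ^n`. -/
def PosOrthant.toVec {n : ℕ} (x : PosOrthant n) : Fin n → ℝ := fun i => (x i : ℝ)

/-- The norm-one subgroup `{x | x_1 ⋯ x_n = 1}` of the positive orthant. -/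
def normOne (n : ℕ) : Subgroup (PosOrthant n) where
  carrier := {x | ∏ i, x i = 1}
  mul_mem' {x y} hx hy := by
    simp only [Set.mem_ofPred_eq, Pi.mul_apply, Finset.prod_mul_distrib] at *
    rw [hx, hy, one_mul]
  one_mem' := by simp
  inv_mem' {x} hx := by
    simp only [Set.mem_ofPred_eq, Pi.inv_apply, Finset.prod_inv_distrib] at *
    rw [hx, inv_one]

/-- A formal linear combination `D` of open cones is a signed fundamental domain for the action of
`U` on the positive orthant by componentwise multiplication if `∑_{u ∈ U} 1_D(u * x) = 1` for every
`x` in the orthant, where only finitely many terms of the sum are nonzero. -/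
def IsSignedFundamentalDomain {n : ℕ} (U : Subgroup (PosOrthant n))
    (D : FormalConeSum (Fin n → ℝ)) : Prop :=
  ∀ x : PosOrthant n,
    (Function.support fun u : U => D.charFun ((u : PosOrthant n) * x).toVec).Finite ∧
    ∑ᶠ u : U, D.charFun ((u : PosOrthant n) * x).toVec = 1

/-- The vectors `v_{i,σ} = u_{σ(1)} ⋯ u_{σ(i-1)}`, `1 ≤ i ≤ m + 1`. With indices starting at `0`,
the vector of index `i` is the product of the `u (σ k)` with `k < i`. -/
def orderedProd {m : ℕ} (u : Fin m → PosOrthant (m + 1)) (σ : Equiv.Perm (Fin m))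
    (i : Fin (m + 1)) : PosOrthant (m + 1) :=
  ∏ k : Fin m with k.castSucc < i, u (σ k)

/-- The orientation `w_u = sign det (log u_{ij})`, where `j` runs over all but the last
coordinate. -/
def logOrientation {m : ℕ} (u : Fin m → PosOrthant (m + 1)) : ℤ :=
  (SignType.sign (Matrix.of fun i j : Fin m => Real.log (u i j.castSucc : ℝ)).det : ℤ)

/-- The weight `w_σ = (-1)^m w_u sign(σ) sign(det(v_{1,σ}, …, v_{m+1,σ}))`. -/
def coneWeight {m : ℕ} (u : Fin m → PosOrthant (m + 1)) (σ : Equiv.Perm (Fin m)) : ℤ :=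
  (-1) ^ m * logOrientation u * (Equiv.Perm.sign σ : ℤ) *
    (SignType.sign (Matrix.of fun i => (orderedProd u σ i).toVec).det : ℤ)

/-- The last coordinate basis vector `(0, …, 0, 1)` of `ℝ^(m+1)`. -/
def lastBasisVec (m : ℕ) : Fin (m + 1) → ℝ := Pi.single (Fin.last m) 1

end

/-! Exponents identify `U` with `ℤᵐ`, and the translate by `u^z` of the cone on the `v_{i,σ}` is the
cone on the images under `z ↦ u^z` of the vertices of a simplex of the Kuhn triangulation of `ℝᵐ`
(`prod_zpow_kuhnVertex`). Summing over `U` therefore counts, with orientation signs, how often the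
images of all Kuhn simplices cover `x`. In logarithmic coordinates relative to the last one, `z ↦
u^z` is a linear isomorphism, so this count should be a mapping degree, up to sign the sign of a
determinant.

The degree is computed by induction on `m` (`IsLogQuasilinear.kuhnSum_eq`), without topology. By the
cocycle relation `sum_neg_one_pow_mul_signedCone`, a signed cone is the alternating sum of the cones
joining its facets to `-e 0`, and such a joined cone contains `x` exactly when the ray from `x` in
direction `e 0` meets the facet. Facets interior to a lattice cube cancel in pairs, and those on
opposite sides of a cube cancel after translation, except in the lattice direction `0`, where the
sum telescopes over the layers `z 0 = k` (`sum_layer_eq_sub`). At one end the ray misses the layers.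
At the other the layer lies entirely beyond `x`, and the ray meets it exactly where its projection
along `e 0` covers the projection of `x`: this is the degree one dimension lower. The projected map
is linear only up to a bounded error, so the induction runs over maps with such an error.

This settles generic `x`. For arbitrary `x`, the span hypothesis on `e_n` makes `x + ε e_n` avoid
every relevant wall for small `ε > 0`; only finitely many lattice points matter, so that point can
be moved further to a generic one without changing any term
(`IsLogQuasilinear.finsum_perturbedConeFun`). Discreteness of `U` enters through
`linearIndependent_log`, which makes the determinant nonzero. Its sign then cancels against the
orientation factor in `w_σ`, leaving `1`. -/

noncomputable section

/-! ### Signed cones and their cocycle relation. -/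

open Classical in
/-- The indicator function of the open cone on the rows of a square matrix, multiplied by the sign
of the determinant. -/
def signedCone {n : ℕ} (V : Fin n → Fin n → ℝ) (x : Fin n → ℝ) : ℤ :=
  if x ∈ openCone V then (SignType.sign (Matrix.of V).det : ℤ) else 0

/-- Cones on different subfamilies become comparable once their coefficients share one index set. -/
theorem mem_openCone_comp_succAbove {k : ℕ} {E : Type*} [AddCommGroup E] [Module ℝ E]
    (v : Fin (k + 1) → E) (i : Fin (k + 1)) (x : E) :
    x ∈ openCone (v ∘ i.succAbove) ↔
      ∃ c : Fin (k + 1) → ℝ, c i = 0 ∧ (∀ j, j ≠ i → 0 < c j) ∧ x = ∑ j, c j • v j := by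
  constructor
  · rintro ⟨c, hc, rfl⟩
    refine ⟨i.insertNth 0 c, by simp, fun j hj => ?_, ?_⟩
    · obtain ⟨j, rfl⟩ := Fin.exists_succAbove_eq hj
      simpa using hc j
    · rw [Fin.sum_univ_succAbove _ i]
      simp
  · rintro ⟨c, hci, hc, rfl⟩
    refine ⟨c ∘ i.succAbove, fun j => hc _ (Fin.succAbove_ne i j), ?_⟩
    rw [Fin.sum_univ_succAbove _ i, hci]
    simp

/-- The alternating minors give a linear relation between `n + 1` vectors of `ℝⁿ`. -/
theorem sum_alternating_minors_smul {n : ℕ} (v : Fin (n + 1) → Fin n → ℝ) :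
    ∑ i : Fin (n + 1), ((-1 : ℝ) ^ (i : ℕ) * (Matrix.of (v ∘ i.succAbove)).det) • v i = 0 := by
  ext j
  -- Repeating the `j`th column makes the determinant vanish; expanding along the extra column gives
  -- coordinate `j` of the relation.
  let A : Matrix (Fin (n + 1)) (Fin (n + 1)) ℝ := Matrix.of fun i => Fin.cons (v i j) (v i)
  have hA : A.det = 0 := by
    refine Matrix.det_zero_of_column_eq (i := 0) (j := j.succ) (Fin.succ_ne_zero j).symm ?_
    intro i
    simp [A]
  rw [Matrix.det_succ_column_zero] at hA
  rw [Finset.sum_apply, Pi.zero_apply, ← hA]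
  refine Finset.sum_congr rfl fun i _ => ?_
  have : A.submatrix i.succAbove Fin.succ = Matrix.of (v ∘ i.succAbove) := by
    ext a b
    simp [A]
  rw [this]
  simp [A]
  ring

theorem linearIndependent_of_det_ne_zero {n : ℕ} {V : Fin n → Fin n → ℝ}
    (h : (Matrix.of V).det ≠ 0) : LinearIndependent ℝ V :=
  Matrix.linearIndependent_rows_of_det_ne_zero h

/-- Two expansions of the same vector in `n + 1` vectors of `ℝⁿ` differ by a multiple of a given
relation `l`, as soon as the vectors other than `v i` are independent and `l i ≠ 0`. -/
theorem exists_eq_add_mul_relation {k : ℕ} {E : Type*} [AddCommGroup E] [Module ℝ E]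
    {v : Fin (k + 1) → E} {l : Fin (k + 1) → ℝ} (hl : ∑ i, l i • v i = 0) {i : Fin (k + 1)}
    (hli : l i ≠ 0) (hv : LinearIndependent ℝ (v ∘ i.succAbove)) {c d : Fin (k + 1) → ℝ}
    (hcd : ∑ j, c j • v j = ∑ j, d j • v j) : ∃ t : ℝ, ∀ j, d j = c j + t * l j := by
  refine ⟨(d i - c i) / l i, ?_⟩
  set t := (d i - c i) / l i with ht
  have hti : t * l i = d i - c i := by rw [ht]; field_simp
  have h0 : ∑ j, (d j - c j - t * l j) • v j = 0 := by
    simp only [sub_smul, mul_smul, Finset.sum_sub_distrib, ← Finset.smul_sum]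
    rw [hl, hcd]
    simp
  rw [Fin.sum_univ_succAbove _ i, hti] at h0
  simp only [sub_self, zero_smul, zero_add] at h0
  have h1 := Fintype.linearIndependent_iff.1 hv _ h0
  intro j
  by_cases hj : j = i
  · subst hj; linarith
  · obtain ⟨j, rfl⟩ := Fin.exists_succAbove_eq hj
    linarith [h1 j]

section Crossing

variable {k : ℕ} {E : Type*} [AddCommGroup E] [Module ℝ E] {v : Fin (k + 2) → E}
  {l : Fin (k + 2) → ℝ} {x : E}

/-- The two expansions of `x` differ by `t • l`. If `i ≠ j`, the coefficient at `i` forces `t > 0`,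
while the one at `j` drops from positive to zero although `l j > 0`. -/
theorem eq_of_mem_openCone_of_pos (hl : ∑ i, l i • v i = 0)
    (hv : ∀ i, l i ≠ 0 → LinearIndependent ℝ (v ∘ i.succAbove)) {i j : Fin (k + 2)}
    (hi : 0 < l i) (hj : 0 < l j) (hxi : x ∈ openCone (v ∘ i.succAbove))
    (hxj : x ∈ openCone (v ∘ j.succAbove)) : i = j := by
  by_contra hij
  obtain ⟨c, hci, hc, hcx⟩ := (mem_openCone_comp_succAbove v i x).1 hxi
  obtain ⟨d, hdj, hd, hdx⟩ := (mem_openCone_comp_succAbove v j x).1 hxj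
  obtain ⟨t, ht⟩ := exists_eq_add_mul_relation hl hi.ne' (hv i hi.ne') (hcx.symm.trans hdx)
  have h1 := ht i
  have h2 := ht j
  have h3 := hd i hij
  have h4 := hc j (Ne.symm hij)
  have ht0 : 0 < t := by
    have : 0 < t * l i := by linarith
    exact pos_of_mul_pos_left this hi.le
  have := mul_pos ht0 hj
  linarith

/-- Ratio test of the simplex method: starting from the expansion of `x` without `v i`, add
multiples of `l` until the first coefficient reaches zero. The functional `f` guarantees that `l`
has a negative entry, and genericity of `x` that only one coefficient vanishes. -/
theorem exists_mem_openCone_of_neg (hl : ∑ i, l i • v i = 0)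
    (hx : ∀ s : Fin k → Fin (k + 2), x ∉ Submodule.span ℝ (Set.range (v ∘ s)))
    (f : E →ₗ[ℝ] ℝ) (hf : ∀ i, 0 < f (v i)) {i : Fin (k + 2)} (hi : 0 < l i)
    (hxi : x ∈ openCone (v ∘ i.succAbove)) :
    ∃ j, l j < 0 ∧ x ∈ openCone (v ∘ j.succAbove) := by
  obtain ⟨c, hci, hc, hcx⟩ := (mem_openCone_comp_succAbove v i x).1 hxi
  have hneg : ∃ j, l j < 0 := by
    by_contra! hcon
    have h0 : ∑ j, l j * f (v j) = 0 := by simpa using congrArg f hl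
    have h1 := (Finset.sum_eq_zero_iff_of_nonneg
      (fun j _ => mul_nonneg (hcon j) (hf j).le)).1 h0 i (Finset.mem_univ _)
    exact (mul_pos hi (hf i)).ne' h1
  have hne : (Finset.univ.filter fun j => l j < 0).Nonempty := by
    obtain ⟨j, hj⟩ := hneg
    exact ⟨j, by simpa using hj⟩
  obtain ⟨j, hj, hmin⟩ := Finset.exists_min_image _ (fun j => c j / (-l j)) hne
  simp only [Finset.mem_filter, Finset.mem_univ, true_and] at hj hmin
  have hji : j ≠ i := by rintro rfl; linarith
  set t := c j / (-l j) with ht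
  have ht0 : 0 < t := div_pos (hc j hji) (by linarith)
  have hdj : c j + t * l j = 0 := by
    have : l j ≠ 0 := hj.ne
    rw [ht, div_neg, neg_mul, div_mul_cancel₀ _ this, add_neg_cancel]
  have hnonneg : ∀ p, 0 ≤ c p + t * l p := by
    intro p
    have hcp : 0 ≤ c p := by
      by_cases hp : p = i
      · rw [hp, hci]
      · exact (hc p hp).le
    by_cases hp : l p < 0
    · have := hmin p hp
      rw [le_div_iff₀ (by linarith)] at this
      linarith
    · have := mul_nonneg ht0.le (not_lt.1 hp)
      linarith
  have hxd : x = ∑ p, (c p + t * l p) • v p := by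
    simp only [add_smul, mul_smul, Finset.sum_add_distrib, ← Finset.smul_sum, hl]
    simpa using hcx
  refine ⟨j, hj, (mem_openCone_comp_succAbove v j x).2 ⟨fun p => c p + t * l p, hdj, ?_, hxd⟩⟩
  intro p hp
  refine lt_of_le_of_ne (hnonneg p) fun hp0 => ?_
  obtain ⟨q, rfl⟩ := Fin.exists_succAbove_eq hp
  -- A second vanishing coefficient would leave `x` in the span of the remaining `k` vectors.
  apply hx (j.succAbove ∘ q.succAbove)
  have hp0' : c (j.succAbove q) + t * l (j.succAbove q) = 0 := hp0.symm
  rw [hxd, Fin.sum_univ_succAbove _ j, hdj, Fin.sum_univ_succAbove _ q, hp0']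
  simp only [zero_smul, zero_add]
  exact Submodule.sum_mem _ fun r _ => Submodule.smul_mem _ _ (Submodule.subset_span ⟨r, rfl⟩)

open Classical in
-- Each count is at most one, and a cone of one sign forces a cone of the other; replacing `l` by
-- `-l` gives the reverse inequality.
theorem card_pos_eq_card_neg (hl : ∑ i, l i • v i = 0)
    (hv : ∀ i, l i ≠ 0 → LinearIndependent ℝ (v ∘ i.succAbove))
    (hx : ∀ s : Fin k → Fin (k + 2), x ∉ Submodule.span ℝ (Set.range (v ∘ s)))
    (f : E →ₗ[ℝ] ℝ) (hf : ∀ i, 0 < f (v i)) :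
    (Finset.univ.filter fun i => 0 < l i ∧ x ∈ openCone (v ∘ i.succAbove)).card =
      (Finset.univ.filter fun i => l i < 0 ∧ x ∈ openCone (v ∘ i.succAbove)).card := by
  have key : ∀ l' : Fin (k + 2) → ℝ, ∑ i, l' i • v i = 0 →
      (∀ i, l' i ≠ 0 → LinearIndependent ℝ (v ∘ i.succAbove)) →
      (Finset.univ.filter fun i => 0 < l' i ∧ x ∈ openCone (v ∘ i.succAbove)).card ≤
      (Finset.univ.filter fun i => l' i < 0 ∧ x ∈ openCone (v ∘ i.succAbove)).card := by
    intro l' hl' hv'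
    rcases Finset.eq_empty_or_nonempty
      (Finset.univ.filter fun i => 0 < l' i ∧ x ∈ openCone (v ∘ i.succAbove)) with h | ⟨i, h⟩
    · rw [h]; simp
    · simp only [Finset.mem_filter, Finset.mem_univ, true_and] at h
      obtain ⟨j, hj⟩ := exists_mem_openCone_of_neg hl' hx f hf h.1 h.2
      calc _ ≤ 1 := by
            refine Finset.card_le_one.2 fun p hp q hq => ?_
            simp only [Finset.mem_filter, Finset.mem_univ, true_and] at hp hq
            exact eq_of_mem_openCone_of_pos hl' hv' hp.1 hq.1 hp.2 hq.2
        _ ≤ _ := Finset.card_pos.2 ⟨j, by simpa using hj⟩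
  refine le_antisymm (key l hl hv) ?_
  have := key (fun i => -l i) (by simpa using hl) (fun i hi => hv i (by simpa using hi))
  simpa using this

end Crossing

/-- The cocycle relation of signed cones: the signed cones spanned by `n` of `n + 1` vectors in an
open half space of `ℝⁿ` cancel at every point which is not in the span of `n - 1` of them. -/
theorem sum_neg_one_pow_mul_signedCone {k : ℕ} (v : Fin (k + 2) → Fin (k + 1) → ℝ)
    (x : Fin (k + 1) → ℝ)
    (hx : ∀ s : Fin k → Fin (k + 2), x ∉ Submodule.span ℝ (Set.range (v ∘ s)))
    (f : (Fin (k + 1) → ℝ) →ₗ[ℝ] ℝ) (hf : ∀ i, 0 < f (v i)) :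
    ∑ i : Fin (k + 2), (-1 : ℤ) ^ (i : ℕ) * signedCone (v ∘ i.succAbove) x = 0 := by
  classical
  set l : Fin (k + 2) → ℝ := fun i => (-1 : ℝ) ^ (i : ℕ) * (Matrix.of (v ∘ i.succAbove)).det
    with hl
  have hv : ∀ i, l i ≠ 0 → LinearIndependent ℝ (v ∘ i.succAbove) := fun i hi =>
    linearIndependent_of_det_ne_zero (right_ne_zero_of_mul hi)
  have hcard := card_pos_eq_card_neg (sum_alternating_minors_smul v) hv hx f hf
  have hterm : ∀ i : Fin (k + 2), (-1 : ℤ) ^ (i : ℕ) * signedCone (v ∘ i.succAbove) x =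
      (if 0 < l i ∧ x ∈ openCone (v ∘ i.succAbove) then 1 else 0) -
        (if l i < 0 ∧ x ∈ openCone (v ∘ i.succAbove) then 1 else 0) := by
    intro i
    by_cases hxi : x ∈ openCone (v ∘ i.succAbove)
    · have hs : (SignType.sign (l i) : ℤ) =
          (-1 : ℤ) ^ (i : ℕ) * (SignType.sign (Matrix.of (v ∘ i.succAbove)).det : ℤ) := by
        rw [hl]
        simp [sign_mul, sign_pow]
      rw [signedCone, if_pos hxi, ← hs]
      rcases lt_trichotomy (l i) 0 with h | h | h
      · simp [h, hxi, h.not_gt]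
      · simp [h]
      · simp [h, hxi, h.not_gt]
    · simp [signedCone, hxi]
  rw [Finset.sum_congr rfl fun i _ => hterm i, Finset.sum_sub_distrib, Finset.sum_boole,
    Finset.sum_boole, sub_eq_zero, Nat.cast_inj]
  exact hcard

/-! ### The Kuhn triangulation and cancellation of its faces. -/

/-- The vertices `z + e (σ 0) + ⋯ + e (σ (i - 1))`, `0 ≤ i ≤ m`, of the simplex of the Kuhn
triangulation of `ℝᵐ` belonging to the lattice point `z` and the permutation `σ`. -/
def kuhnVertex {m : ℕ} (z : Fin m → ℤ) (σ : Equiv.Perm (Fin m)) (i : Fin (m + 1)) : Fin m → ℤ :=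
  fun p => z p + if (σ⁻¹ p).castSucc < i then 1 else 0

theorem kuhnVertex_apply_perm {m : ℕ} (z : Fin m → ℤ) (σ : Equiv.Perm (Fin m)) (i : Fin (m + 1))
    (q : Fin m) : kuhnVertex z σ i (σ q) = z (σ q) + if q.castSucc < i then 1 else 0 := by
  simp [kuhnVertex]

theorem finRotate_castSucc {m : ℕ} (q : Fin m) : finRotate (m + 1) q.castSucc = q.succ := by
  rw [finRotate_of_lt (by simp)]
  ext
  simp

/-- Exchanging two consecutive steps of a lattice path moves only the vertex between them. -/
theorem kuhnVertex_mul_swap {m : ℕ} (z : Fin (m + 1) → ℤ) (σ : Equiv.Perm (Fin (m + 1)))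
    (j : Fin m) (i : Fin (m + 2)) (hi : i ≠ j.succ.castSucc) :
    kuhnVertex z (σ * Equiv.swap j.castSucc j.succ) i = kuhnVertex z σ i := by
  ext p
  simp only [kuhnVertex, mul_inv_rev, Equiv.swap_inv, Equiv.Perm.mul_apply]
  congr 2
  generalize σ⁻¹ p = q
  rw [Equiv.swap_apply_def]
  simp only [Fin.ext_iff, Fin.lt_def, ne_eq, Fin.val_castSucc, Fin.val_succ] at *
  split_ifs with h1 h2 <;> simp only [Fin.val_castSucc, Fin.val_succ, eq_iff_iff] <;> omega

/-- Adjacent Kuhn simplices over the same cube cancel along interior faces. -/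
theorem sum_sign_mul_interior_face {m : ℕ} (z : Fin (m + 1) → ℤ) (j : Fin m)
    (γ : (Fin (m + 1) → Fin (m + 1) → ℤ) → ℤ) :
    ∑ σ : Equiv.Perm (Fin (m + 1)), (Equiv.Perm.sign σ : ℤ) *
      γ (kuhnVertex z σ ∘ j.succ.castSucc.succAbove) = 0 := by
  set S := ∑ σ : Equiv.Perm (Fin (m + 1)), (Equiv.Perm.sign σ : ℤ) *
      γ (kuhnVertex z σ ∘ j.succ.castSucc.succAbove) with hS
  have hne : j.castSucc ≠ j.succ := (Fin.castSucc_lt_succ).ne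
  have h : S = -S := by
    -- The swap preserves the face and reverses the sign, so `S = -S`.
    conv_lhs => rw [hS, ← Equiv.sum_comp (Equiv.mulRight (Equiv.swap j.castSucc j.succ))]
    rw [hS, ← Finset.sum_neg_distrib]
    refine Finset.sum_congr rfl fun σ _ => ?_
    have : kuhnVertex z (σ * Equiv.swap j.castSucc j.succ) ∘ j.succ.castSucc.succAbove =
        kuhnVertex z σ ∘ j.succ.castSucc.succAbove := by
      funext i
      exact kuhnVertex_mul_swap z σ j _ (Fin.succAbove_ne _ _)
    simp only [Equiv.coe_mulRight, this, Equiv.Perm.sign_mul, Equiv.Perm.sign_swap hne]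
    simp
  omega

/-- A path without its first vertex starts at `z + e (σ 0)`; moving the step `σ 0` to the end
presents this face as the face opposite the last vertex of a simplex over a neighbouring cube. -/
theorem kuhnVertex_succ {m : ℕ} (z : Fin (m + 1) → ℤ) (σ : Equiv.Perm (Fin (m + 1)))
    (i : Fin (m + 1)) :
    kuhnVertex z σ i.succ =
      kuhnVertex (z + Pi.single (σ 0) 1) (σ * finRotate (m + 1)) i.castSucc := by
  ext p
  obtain ⟨q, rfl⟩ := (σ * finRotate (m + 1)).surjective p
  rw [kuhnVertex_apply_perm, Equiv.Perm.mul_apply, kuhnVertex_apply_perm, Pi.add_apply,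
    Pi.single_apply]
  induction q using Fin.lastCases with
  | last => simp [Fin.le_last]
  | cast q => simp [finRotate_castSucc, Fin.lt_def, -finRotate_apply]

/-- The alternating sum over the faces of the Kuhn simplices over one cube reduces to the
differences of opposite faces of the cube. -/
theorem sum_sign_mul_sum_face {m : ℕ} (z : Fin (m + 1) → ℤ)
    (γ : (Fin (m + 1) → Fin (m + 1) → ℤ) → ℤ) :
    ∑ σ : Equiv.Perm (Fin (m + 1)), (Equiv.Perm.sign σ : ℤ) *
      ∑ i : Fin (m + 2), (-1 : ℤ) ^ (i : ℕ) * γ (kuhnVertex z σ ∘ i.succAbove) =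
    ∑ σ : Equiv.Perm (Fin (m + 1)), (Equiv.Perm.sign σ : ℤ) *
      (γ (fun i => kuhnVertex (z + Pi.single (σ 0) 1) (σ * finRotate (m + 1)) i.castSucc) -
        γ (fun i => kuhnVertex z (σ * finRotate (m + 1)) i.castSucc)) := by
  have h0 : ∀ σ, kuhnVertex z σ ∘ (0 : Fin (m + 2)).succAbove =
      fun i => kuhnVertex (z + Pi.single (σ 0) 1) (σ * finRotate (m + 1)) i.castSucc := by
    intro σ
    funext i
    rw [Function.comp_apply, Fin.succAbove_zero, kuhnVertex_succ]
  have hl : ∀ σ, kuhnVertex z σ ∘ (Fin.last (m + 1)).succAbove =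
      fun i => kuhnVertex z σ i.castSucc := by
    intro σ
    funext i
    rw [Function.comp_apply, Fin.succAbove_last]
  have hlast : ∑ σ : Equiv.Perm (Fin (m + 1)), (Equiv.Perm.sign σ : ℤ) *
      ((-1) ^ (m + 1) * γ (fun i => kuhnVertex z σ i.castSucc)) =
      ∑ σ : Equiv.Perm (Fin (m + 1)), (Equiv.Perm.sign σ : ℤ) *
        -γ (fun i => kuhnVertex z (σ * finRotate (m + 1)) i.castSucc) := by
    -- The rotation has sign `(-1) ^ m`, which combines with the face sign `(-1) ^ (m + 1)` to `-1`.
    rw [← Equiv.sum_comp (Equiv.mulRight (finRotate (m + 1)))]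
    refine Finset.sum_congr rfl fun σ _ => ?_
    rw [Equiv.coe_mulRight, Equiv.Perm.sign_mul, sign_finRotate]
    push_cast
    have : ((-1 : ℤ)) ^ m * (-1) ^ (m + 1) = -1 := by
      rw [← pow_add, ← add_assoc, ← two_mul, pow_succ, pow_mul]; simp
    linear_combination (Equiv.Perm.sign σ : ℤ) *
      γ (fun i => kuhnVertex z (σ * finRotate (m + 1)) i.castSucc) * this
  have hmid : ∑ σ : Equiv.Perm (Fin (m + 1)), (Equiv.Perm.sign σ : ℤ) *
      ∑ j : Fin m, (-1 : ℤ) ^ (j.succ.castSucc : ℕ) *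
        γ (kuhnVertex z σ ∘ j.succ.castSucc.succAbove) = 0 := by
    simp only [Finset.mul_sum]
    rw [Finset.sum_comm]
    refine Finset.sum_eq_zero fun j _ => ?_
    simp only [mul_left_comm _ ((-1 : ℤ) ^ _)]
    rw [← Finset.mul_sum, sum_sign_mul_interior_face, mul_zero]
  simp only [sub_eq_add_neg, mul_add, Finset.sum_add_distrib]
  rw [← hlast, ← add_zero (Finset.sum _ _ + _), ← hmid, ← Finset.sum_add_distrib,
    ← Finset.sum_add_distrib]
  refine Finset.sum_congr rfl fun σ _ => ?_
  rw [Fin.sum_univ_castSucc, Fin.sum_univ_succ, hl, Fin.castSucc_zero, h0]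
  simp only [Fin.val_zero, pow_zero, one_mul, Fin.val_last, Fin.val_castSucc]
  ring

/-- After the rotation the step in direction `0` comes last, so the path without its last vertex
stays in the layer `k` and is a Kuhn simplex one dimension lower. -/
theorem kuhnVertex_cons_decomposeFin {m : ℕ} (k : ℤ) (z : Fin m → ℤ) (τ : Equiv.Perm (Fin m))
    (i : Fin (m + 1)) :
    kuhnVertex (Fin.cons k z : Fin (m + 1) → ℤ)
      (Equiv.Perm.decomposeFin.symm (0, τ) * finRotate (m + 1)) i.castSucc =
    Fin.cons k (kuhnVertex z τ i) := by
  set σ := Equiv.Perm.decomposeFin.symm (0, τ) with hσ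
  ext p
  obtain ⟨q, rfl⟩ := (σ * finRotate (m + 1)).surjective p
  rw [kuhnVertex_apply_perm]
  induction q using Fin.lastCases with
  | last =>
    have : (σ * finRotate (m + 1)) (Fin.last m) = 0 := by simp [hσ]
    rw [this]
    simp [Fin.le_last]
  | cast q =>
    have : (σ * finRotate (m + 1)) q.castSucc = (τ q).succ := by
      rw [Equiv.Perm.mul_apply, finRotate_castSucc]
      simp [hσ]
    rw [this]
    simp [kuhnVertex_apply_perm]

/-! ### Logarithmic coordinates and local finiteness. -/

/-- Logarithms of the coordinates of a positive vector, relative to the last coordinate. -/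
def logRatio {m : ℕ} (x : Fin (m + 1) → ℝ) (j : Fin m) : ℝ :=
  Real.log (x j.castSucc) - Real.log (x (Fin.last m))

theorem openCone_pos {ι κ : Type*} [Fintype ι] [Nonempty ι] {V : ι → κ → ℝ} {x : κ → ℝ}
    (hV : ∀ i j, 0 < V i j) (hx : x ∈ openCone V) (j : κ) : 0 < x j := by
  obtain ⟨c, hc, rfl⟩ := hx
  rw [Finset.sum_apply]
  exact Finset.sum_pos (fun i _ => mul_pos (hc i) (hV i j)) Finset.univ_nonempty

/-- The bound says that `exp (w - K)` and `exp (w + K)` times the last coordinate enclose coordinate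
`j`. These are homogeneous linear inequalities, hence inherited by positive combinations. -/
theorem abs_logRatio_sub_le_of_mem_openCone {ι : Type*} [Fintype ι] [Nonempty ι] {m : ℕ}
    {V : ι → Fin (m + 1) → ℝ} {x : Fin (m + 1) → ℝ} {j : Fin m} {w K : ℝ}
    (hV : ∀ i j, 0 < V i j) (hw : ∀ i, |logRatio (V i) j - w| ≤ K) (hx : x ∈ openCone V) :
    |logRatio x j - w| ≤ K := by
  have hpos := openCone_pos hV hx
  obtain ⟨c, hc, rfl⟩ := hx
  set y : Fin (m + 1) → ℝ := ∑ i, c i • V i with hy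
  have hyj : ∀ p, y p = ∑ i, c i * V i p := fun p => by simp [hy]
  have e1 : y j.castSucc ≤ Real.exp (w + K) * y (Fin.last m) := by
    rw [hyj, hyj, Finset.mul_sum]
    refine Finset.sum_le_sum fun i _ => ?_
    have h1 := (abs_le.1 (hw i)).2
    have h2 : V i j.castSucc ≤ Real.exp (w + K) * V i (Fin.last m) := by
      rw [← Real.log_le_log_iff (hV _ _) (mul_pos (Real.exp_pos _) (hV _ _)),
        Real.log_mul (Real.exp_pos _).ne' (hV _ _).ne', Real.log_exp]
      simp only [logRatio] at h1
      linarith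
    calc _ ≤ c i * (Real.exp (w + K) * V i (Fin.last m)) := mul_le_mul_of_nonneg_left h2 (hc i).le
      _ = _ := by ring
  have e2 : Real.exp (w - K) * y (Fin.last m) ≤ y j.castSucc := by
    rw [hyj, hyj, Finset.mul_sum]
    refine Finset.sum_le_sum fun i _ => ?_
    have h1 := (abs_le.1 (hw i)).1
    have h2 : Real.exp (w - K) * V i (Fin.last m) ≤ V i j.castSucc := by
      rw [← Real.log_le_log_iff (mul_pos (Real.exp_pos _) (hV _ _)) (hV _ _),
        Real.log_mul (Real.exp_pos _).ne' (hV _ _).ne', Real.log_exp]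
      simp only [logRatio] at h1
      linarith
    calc _ = c i * (Real.exp (w - K) * V i (Fin.last m)) := by ring
      _ ≤ _ := mul_le_mul_of_nonneg_left h2 (hc i).le
  rw [← Real.log_le_log_iff (hpos _) (mul_pos (Real.exp_pos _) (hpos _)),
    Real.log_mul (Real.exp_pos _).ne' (hpos _).ne', Real.log_exp] at e1
  rw [← Real.log_le_log_iff (mul_pos (Real.exp_pos _) (hpos _)) (hpos _),
    Real.log_mul (Real.exp_pos _).ne' (hpos _).ne', Real.log_exp] at e2
  simp only [logRatio]
  rw [abs_le]
  constructor <;> linarith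

/-- The map `a` from `ℤᵐ` to positive vectors agrees in logarithmic coordinates with the linear
map `M`, up to an error of at most `K`. -/
structure IsLogQuasilinear {m : ℕ} (a : (Fin m → ℤ) → Fin (m + 1) → ℝ)
    (M : Matrix (Fin m) (Fin m) ℝ) (K : ℝ) : Prop where
  pos : ∀ z i, 0 < a z i
  bound : ∀ z j, |logRatio (a z) j - M.mulVec (fun p => (z p : ℝ)) j| ≤ K

/-- An error bound for the values at the vertices of a Kuhn simplex. -/
def kuhnBound {m : ℕ} (M : Matrix (Fin m) (Fin m) ℝ) (K : ℝ) : ℝ :=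
  K + ∑ j, ∑ p, |M j p|

theorem IsLogQuasilinear.abs_sub_le {m : ℕ} {a : (Fin m → ℤ) → Fin (m + 1) → ℝ}
    {M : Matrix (Fin m) (Fin m) ℝ} {K : ℝ} (h : IsLogQuasilinear a M K) (z : Fin m → ℤ)
    (σ : Equiv.Perm (Fin m)) (i : Fin (m + 1)) (j : Fin m) :
    |logRatio (a (kuhnVertex z σ i)) j - M.mulVec (fun p => (z p : ℝ)) j| ≤ kuhnBound M K := by
  have h1 := h.bound (kuhnVertex z σ i) j
  have h2 : |M.mulVec (fun p => (kuhnVertex z σ i p : ℝ)) j - M.mulVec (fun p => (z p : ℝ)) j| ≤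
      ∑ j, ∑ p, |M j p| := by
    calc |M.mulVec (fun p => (kuhnVertex z σ i p : ℝ)) j - M.mulVec (fun p => (z p : ℝ)) j|
        = |∑ p, M j p * ((if (σ⁻¹ p).castSucc < i then 1 else 0 : ℤ) : ℝ)| := by
          simp only [Matrix.mulVec, dotProduct, kuhnVertex]
          rw [← Finset.sum_sub_distrib]
          congr 1
          refine Finset.sum_congr rfl fun p _ => ?_
          push_cast
          ring
      _ ≤ ∑ p, |M j p| := by
          refine (Finset.abs_sum_le_sum_abs _ _).trans (Finset.sum_le_sum fun p _ => ?_)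
          split_ifs <;> simp
      _ ≤ _ := Finset.single_le_sum (f := fun j => ∑ p, |M j p|)
          (fun j _ => Finset.sum_nonneg fun p _ => abs_nonneg _) (Finset.mem_univ j)
  have h3 := abs_add_le (logRatio (a (kuhnVertex z σ i)) j -
      M.mulVec (fun p => (kuhnVertex z σ i p : ℝ)) j)
    (M.mulVec (fun p => (kuhnVertex z σ i p : ℝ)) j - M.mulVec (fun p => (z p : ℝ)) j)
  rw [sub_add_sub_cancel] at h3
  rw [kuhnBound]
  linarith

theorem finite_setOf_abs_mulVec_le {m : ℕ} {M : Matrix (Fin m) (Fin m) ℝ} (hM : M.det ≠ 0)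
    (B : ℝ) : {z : Fin m → ℤ | ∀ j, |M.mulVec (fun p => (z p : ℝ)) j| ≤ B}.Finite := by
  set C := ∑ p, ∑ j, |M⁻¹ p j| * B with hC
  refine (Set.finite_Icc (fun _ => -⌈C⌉) (fun _ => ⌈C⌉)).subset fun z hz => ?_
  have hz' : ∀ p, |(z p : ℝ)| ≤ C := by
    intro p
    have hB : 0 ≤ B := (abs_nonneg _).trans (hz p)
    have h1 : (z p : ℝ) = ∑ j, M⁻¹ p j * M.mulVec (fun p => (z p : ℝ)) j := by
      have : M⁻¹.mulVec (M.mulVec (fun p => (z p : ℝ))) p = z p := by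
        rw [Matrix.mulVec_mulVec, Matrix.nonsing_inv_mul _ (isUnit_iff_ne_zero.2 hM),
          Matrix.one_mulVec]
      rw [← this]
      rfl
    rw [h1]
    calc _ ≤ ∑ j, |M⁻¹ p j| * B := by
          refine (Finset.abs_sum_le_sum_abs _ _).trans (Finset.sum_le_sum fun j _ => ?_)
          rw [abs_mul]
          exact mul_le_mul_of_nonneg_left (hz j) (abs_nonneg _)
      _ ≤ C := Finset.single_le_sum (f := fun p => ∑ j, |M⁻¹ p j| * B)
          (fun p _ => Finset.sum_nonneg fun j _ => mul_nonneg (abs_nonneg _) hB)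
          (Finset.mem_univ p)
  constructor <;> intro p <;> have h1 := abs_le.1 (hz' p) <;> have h2 := Int.le_ceil C
  · have : ((-⌈C⌉ : ℤ) : ℝ) ≤ z p := by push_cast; linarith
    exact_mod_cast this
  · have : (z p : ℝ) ≤ (⌈C⌉ : ℤ) := by linarith
    exact_mod_cast this

/-- A point of the cone over `z` has log ratios near `M z`, so bounded log ratios bound `z`.
Uniformity in `y` is what later permits moving the point. -/
theorem IsLogQuasilinear.finite_setOf_mem_openCone {m : ℕ} {a : (Fin m → ℤ) → Fin (m + 1) → ℝ}
    {M : Matrix (Fin m) (Fin m) ℝ} {K : ℝ} (h : IsLogQuasilinear a M K) (hM : M.det ≠ 0) (B : ℝ) :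
    {z | ∃ σ y, (∀ j, |logRatio y j| ≤ B) ∧
      y ∈ openCone fun i => a (kuhnVertex z σ i)}.Finite := by
  refine (finite_setOf_abs_mulVec_le hM (B + kuhnBound M K)).subset ?_
  rintro z ⟨σ, y, hy, hyz⟩ j
  have h1 := abs_logRatio_sub_le_of_mem_openCone (fun i j => h.pos _ j)
    (fun i => h.abs_sub_le z σ i j) hyz
  have h2 := hy j
  rw [abs_le] at *
  constructor <;> linarith

/-! ### The total signed count and relabelling of lattice coordinates. -/

/-- The sum of the signed cones on the images of all simplices of the Kuhn triangulation. -/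
def kuhnSum {m : ℕ} (a : (Fin m → ℤ) → Fin (m + 1) → ℝ) (x : Fin (m + 1) → ℝ) : ℤ :=
  ∑ σ : Equiv.Perm (Fin m), (Equiv.Perm.sign σ : ℤ) *
    ∑ᶠ z : Fin m → ℤ, signedCone (fun i => a (kuhnVertex z σ i)) x

theorem mem_openCone_of_signedCone_ne_zero {n : ℕ} {V : Fin n → Fin n → ℝ} {x : Fin n → ℝ}
    (h : signedCone V x ≠ 0) : x ∈ openCone V := by
  by_contra hx
  exact h (by rw [signedCone, if_neg hx])

theorem kuhnVertex_comp_perm {m : ℕ} (g : Equiv.Perm (Fin m)) (z : Fin m → ℤ)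
    (σ : Equiv.Perm (Fin m)) (i : Fin (m + 1)) :
    kuhnVertex z σ i ∘ g = kuhnVertex (z ∘ g) (g⁻¹ * σ) i := by
  ext p
  simp [kuhnVertex]

theorem kuhnSum_comp_perm {m : ℕ} (g : Equiv.Perm (Fin m)) (a : (Fin m → ℤ) → Fin (m + 1) → ℝ)
    (x : Fin (m + 1) → ℝ) :
    kuhnSum (fun z => a (z ∘ g)) x = (Equiv.Perm.sign g : ℤ) * kuhnSum a x := by
  rw [kuhnSum, kuhnSum, Finset.mul_sum, ← Equiv.sum_comp (Equiv.mulLeft g)]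
  refine Finset.sum_congr rfl fun σ _ => ?_
  simp only [kuhnVertex_comp_perm, Equiv.coe_mulLeft, inv_mul_cancel_left, Equiv.Perm.sign_mul]
  rw [← finsum_comp_equiv (Equiv.arrowCongr g (Equiv.refl ℤ))]
  push_cast
  rw [mul_assoc]
  congr 3
  funext z
  have : (Equiv.arrowCongr g (Equiv.refl ℤ)) z ∘ g = z := by
    ext p
    simp
  rw [this]

theorem IsLogQuasilinear.comp_perm {m : ℕ} {a : (Fin m → ℤ) → Fin (m + 1) → ℝ}
    {M : Matrix (Fin m) (Fin m) ℝ} {K : ℝ} (h : IsLogQuasilinear a M K)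
    (g : Equiv.Perm (Fin m)) :
    IsLogQuasilinear (fun z => a (z ∘ g)) (M.submatrix id g.symm) K := by
  refine ⟨fun z => h.pos _, fun z j => ?_⟩
  convert h.bound (z ∘ g) j using 3
  simp only [Matrix.mulVec, dotProduct, Matrix.submatrix_apply, id]
  rw [← Equiv.sum_comp g]
  simp

/-! ### Cones joined to `-e 0` and rays in direction `e 0`. -/

theorem mem_openCone_cons_neg_single {k : ℕ} (V : Fin k → Fin (k + 1) → ℝ)
    (x : Fin (k + 1) → ℝ) :
    x ∈ openCone (Fin.cons (-Pi.single 0 1) V : Fin (k + 1) → Fin (k + 1) → ℝ) ↔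
      ∃ y ∈ openCone V, y ∘ Fin.succ = x ∘ Fin.succ ∧ x 0 < y 0 := by
  constructor
  · rintro ⟨c, hc, rfl⟩
    refine ⟨∑ i, c i.succ • V i, ⟨fun i => c i.succ, fun i => hc _, rfl⟩, ?_, ?_⟩
    · ext j
      simp [Fin.sum_univ_succ]
    · simp [Fin.sum_univ_succ, hc 0]
  · rintro ⟨y, ⟨c, hc, hy⟩, hyx, hlt⟩
    refine ⟨Fin.cons (y 0 - x 0) c, ?_, ?_⟩
    · intro i
      induction i using Fin.cases with
      | zero => simpa using hlt
      | succ i => simpa using hc i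
    · rw [Fin.sum_univ_succ]
      simp only [Fin.cons_zero, Fin.cons_succ, ← hy]
      ext j
      induction j using Fin.cases with
      | zero => simp
      | succ j => simpa using (congrFun hyx j).symm

theorem det_cons_neg_single {k : ℕ} (V : Fin k → Fin (k + 1) → ℝ) :
    (Matrix.of (Fin.cons (-Pi.single 0 1) V : Fin (k + 1) → Fin (k + 1) → ℝ)).det =
      -(Matrix.of fun i => V i ∘ Fin.succ).det := by
  rw [Matrix.det_succ_row_zero, Fin.sum_univ_succ]
  have : (Matrix.of (Fin.cons (-Pi.single 0 1) V : Fin (k + 1) → Fin (k + 1) → ℝ)).submatrix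
      Fin.succ (Fin.succAbove 0) = Matrix.of fun i => V i ∘ Fin.succ := by
    ext i j
    simp
  rw [this]
  simp

/-- When the whole fibre of the cone lies beyond `x`, the ray meets the cone as soon as the
projections do. The minus sign is that of the generator `-e 0` in the determinant. -/
theorem signedCone_cons_of_lt {k : ℕ} {V : Fin k → Fin (k + 1) → ℝ} {x : Fin (k + 1) → ℝ}
    (h : ∀ y ∈ openCone V, y ∘ Fin.succ = x ∘ Fin.succ → x 0 < y 0) :
    signedCone (Fin.cons (-Pi.single 0 1) V : Fin (k + 1) → Fin (k + 1) → ℝ) x =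
      -signedCone (fun i => V i ∘ Fin.succ) (x ∘ Fin.succ) := by
  have hiff : x ∈ openCone (Fin.cons (-Pi.single 0 1) V : Fin (k + 1) → Fin (k + 1) → ℝ) ↔
      x ∘ Fin.succ ∈ openCone fun i => V i ∘ Fin.succ := by
    rw [mem_openCone_cons_neg_single]
    constructor
    · rintro ⟨y, ⟨c, hc, rfl⟩, hy, -⟩
      refine ⟨c, hc, ?_⟩
      rw [← hy]
      ext j
      simp
    · rintro ⟨c, hc, hx⟩
      have hy : (∑ i, c i • V i) ∘ Fin.succ = x ∘ Fin.succ := by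
        rw [hx]
        ext j
        simp
      exact ⟨∑ i, c i • V i, ⟨c, hc, rfl⟩, hy, h _ ⟨c, hc, rfl⟩ hy⟩
  rw [signedCone, signedCone, det_cons_neg_single, Left.sign_neg]
  by_cases hx : x ∘ Fin.succ ∈ openCone fun i => V i ∘ Fin.succ
  · rw [if_pos hx, if_pos (hiff.2 hx)]
    simp
  · rw [if_neg hx, if_neg (mt hiff.1 hx), neg_zero]

theorem signedCone_cons_of_gt {k : ℕ} {V : Fin k → Fin (k + 1) → ℝ} {x : Fin (k + 1) → ℝ}
    (h : ∀ y ∈ openCone V, y ∘ Fin.succ = x ∘ Fin.succ → y 0 < x 0) :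
    signedCone (Fin.cons (-Pi.single 0 1) V : Fin (k + 1) → Fin (k + 1) → ℝ) x = 0 := by
  by_contra hne
  obtain ⟨y, hy, hyx, hlt⟩ :=
    (mem_openCone_cons_neg_single V x).1 (mem_openCone_of_signedCone_ne_zero hne)
  exact (h y hy hyx).not_gt hlt

/-- A signed cone as an alternating sum of the cones joining its faces to `-e 0`. -/
theorem signedCone_eq_sum_faces {k : ℕ} (V : Fin (k + 2) → Fin (k + 2) → ℝ)
    (hV : ∀ i j, 0 < V i j) (x : Fin (k + 2) → ℝ)
    (hx : ∀ s : Fin (k + 1) → Fin (k + 3), x ∉ Submodule.span ℝ (Set.range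
      ((Fin.cons (-Pi.single 0 1) V : Fin (k + 3) → Fin (k + 2) → ℝ) ∘ s))) :
    signedCone V x = ∑ i : Fin (k + 2), (-1 : ℤ) ^ (i : ℕ) *
      signedCone (Fin.cons (-Pi.single 0 1) (V ∘ i.succAbove)
        : Fin (k + 2) → Fin (k + 2) → ℝ) x := by
  -- The functional `C * (last coordinate) - (coordinate 0)` takes the value `1` on `-e 0`, and for
  -- large `C` it is positive on the rows of `V`.
  obtain ⟨C, hC⟩ : ∃ C : ℝ, ∀ i, V i 0 < C * V i (Fin.last (k + 1)) := by
    obtain ⟨C, hC⟩ := (Set.finite_range fun i => V i 0 / V i (Fin.last (k + 1))).bddAbove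
    refine ⟨C + 1, fun i => ?_⟩
    have h1 := hC ⟨i, rfl⟩
    simp only at h1
    rw [← div_lt_iff₀ (hV _ _)]
    linarith
  let f : (Fin (k + 2) → ℝ) →ₗ[ℝ] ℝ :=
    C • LinearMap.proj (Fin.last (k + 1)) - LinearMap.proj 0
  have hf : ∀ i, 0 < f ((Fin.cons (-Pi.single 0 1) V : Fin (k + 3) → Fin (k + 2) → ℝ) i) := by
    intro i
    induction i using Fin.cases with
    | zero => simp [f]
    | succ i => simpa [f] using hC i
  have h := sum_neg_one_pow_mul_signedCone _ x hx f hf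
  rw [Fin.sum_univ_succ] at h
  have h0 : (Fin.cons (-Pi.single 0 1) V : Fin (k + 3) → Fin (k + 2) → ℝ) ∘
      (0 : Fin (k + 3)).succAbove = V := by
    funext i
    simp
  have hs : ∀ i : Fin (k + 2), (Fin.cons (-Pi.single 0 1) V : Fin (k + 3) → Fin (k + 2) → ℝ) ∘
      i.succ.succAbove = (Fin.cons (-Pi.single 0 1) (V ∘ i.succAbove)
        : Fin (k + 2) → Fin (k + 2) → ℝ) := by
    intro i
    funext j
    induction j using Fin.cases with
    | zero => simp
    | succ j => simp
  simp only [h0, hs, Fin.val_zero, pow_zero, one_mul, Fin.val_succ, pow_succ, mul_neg, mul_one,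
    neg_mul, Finset.sum_neg_distrib] at h
  linarith

/-! ### Ray crossings, layers of the lattice and telescoping. -/

/-- The intersection number of the ray from `x` in direction `e 0` with the cone on the images of
lattice points `F`. -/
def rayCrossing {m : ℕ} (a : (Fin (m + 1) → ℤ) → Fin (m + 2) → ℝ) (x : Fin (m + 2) → ℝ)
    (F : Fin (m + 1) → Fin (m + 1) → ℤ) : ℤ :=
  signedCone (Fin.cons (-Pi.single 0 1) (a ∘ F) : Fin (m + 2) → Fin (m + 2) → ℝ) x

theorem finsum_sub_of_eventually_const {h : ℤ → ℤ} {A B N : ℤ} (hA : ∀ k, N ≤ k → h k = A)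
    (hB : ∀ k, k ≤ -N → h k = B) : ∑ᶠ k, (h (k + 1) - h k) = A - B := by
  obtain ⟨n, hn⟩ : ∃ n : ℕ, N ≤ n := ⟨N.toNat, Int.self_le_toNat N⟩
  have htel : ∀ l : ℕ, ∑ k ∈ Finset.range l, (h (-n + k + 1) - h (-n + k)) =
      h (-n + l) - h (-n) := by
    intro l
    induction l with
    | zero => simp
    | succ l ih =>
      rw [Finset.sum_range_succ, ih]
      push_cast
      rw [add_assoc]
      ring
  let φ : ℕ ↪ ℤ := ⟨fun k => -n + k, fun a b hab => by simpa using hab⟩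
  rw [finsum_eq_sum_of_support_subset (s := (Finset.range (2 * n)).map φ), Finset.sum_map]
  · refine (htel (2 * n)).trans ?_
    rw [hA _ (by push_cast; omega), hB _ (by omega)]
  · intro k hk
    simp only [Function.mem_support] at hk
    simp only [Finset.coe_map, Set.mem_image, Finset.coe_range, Set.mem_Iio]
    by_contra hcon
    apply hk
    by_cases h1 : -(n : ℤ) ≤ k
    · by_cases h2 : k < n
      · exact absurd ⟨(k + n).toNat, by omega, by
          change -(n : ℤ) + ((k + n).toNat : ℤ) = k
          omega⟩ hcon
      · rw [hA _ (by omega), hA _ (by omega), sub_self]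
    · rw [hB _ (by omega), hB _ (by omega), sub_self]

theorem mulVec_cons_succ {m : ℕ} (M : Matrix (Fin (m + 1)) (Fin (m + 1)) ℝ) (k : ℤ)
    (z : Fin m → ℤ) (j : Fin m) :
    M.mulVec (fun p => ((Fin.cons k z : Fin (m + 1) → ℤ) p : ℝ)) j.succ =
      M j.succ 0 * k + (M.submatrix Fin.succ Fin.succ).mulVec (fun p => (z p : ℝ)) j := by
  simp [Matrix.mulVec, dotProduct, Fin.sum_univ_succ]

theorem abs_mul_intCast_le_sum {m : ℕ} (M : Matrix (Fin (m + 1)) (Fin (m + 1)) ℝ) (k : ℤ)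
    (j : Fin (m + 1)) : |M j 0 * k| ≤ (∑ i, |M i 0|) * |(k : ℝ)| := by
  rw [abs_mul]
  exact mul_le_mul_of_nonneg_right (Finset.single_le_sum (f := fun i => |M i 0|)
    (fun i _ => abs_nonneg _) (Finset.mem_univ j)) (abs_nonneg _)

/-- Fixing `z 0 = k` shifts the linear part by `k` times a column of `M`. The bounded error in
`IsLogQuasilinear` exists to absorb this shift; it may depend on `k`. -/
theorem IsLogQuasilinear.layer {m : ℕ} {a : (Fin (m + 1) → ℤ) → Fin (m + 2) → ℝ}
    {M : Matrix (Fin (m + 1)) (Fin (m + 1)) ℝ} {K : ℝ} (h : IsLogQuasilinear a M K) (k : ℤ) :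
    IsLogQuasilinear (fun z => a (Fin.cons k z) ∘ Fin.succ) (M.submatrix Fin.succ Fin.succ)
      (K + (∑ i, |M i 0|) * |(k : ℝ)|) := by
  refine ⟨fun z j => h.pos _ _, fun z j => ?_⟩
  have h1 := h.bound (Fin.cons k z) j.succ
  rw [mulVec_cons_succ] at h1
  have h2 := abs_mul_intCast_le_sum M k j.succ
  have h3 : logRatio (a (Fin.cons k z) ∘ Fin.succ) j = logRatio (a (Fin.cons k z)) j.succ := rfl
  rw [h3]
  rw [abs_le] at *
  constructor <;> linarith

/-- The faces of Kuhn simplices which lie in a coordinate hyperplane `z 0 = k` of the lattice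
(if `σ 0 = 0`), or which connect the hyperplanes `z 0 = k` and `z 0 = k + 1` (otherwise). -/
def layerFace {m : ℕ} (k : ℤ) (z : Fin m → ℤ) (σ : Equiv.Perm (Fin (m + 1)))
    (i : Fin (m + 1)) : Fin (m + 1) → ℤ :=
  kuhnVertex (Fin.cons k z) (σ * finRotate (m + 1)) i.castSucc

theorem IsLogQuasilinear.abs_mulVec_layer_le {m : ℕ} {a : (Fin (m + 1) → ℤ) → Fin (m + 2) → ℝ}
    {M : Matrix (Fin (m + 1)) (Fin (m + 1)) ℝ} {K : ℝ} (h : IsLogQuasilinear a M K) {k : ℤ}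
    {z : Fin m → ℤ} {σ : Equiv.Perm (Fin (m + 1))} {y : Fin (m + 2) → ℝ}
    (hy : y ∈ openCone (a ∘ layerFace k z σ)) (j : Fin (m + 1)) :
    |logRatio y j - M.mulVec (fun p => ((Fin.cons k z : Fin (m + 1) → ℤ) p : ℝ)) j| ≤
      kuhnBound M K := by
  have hV : ∀ i j, 0 < (a ∘ layerFace k z σ) i j := fun i j => h.pos _ j
  refine abs_logRatio_sub_le_of_mem_openCone hV (fun i => ?_) hy
  exact h.abs_sub_le (Fin.cons k z) (σ * finRotate (m + 1)) i.castSucc j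

theorem logRatio_succ_eq {m : ℕ} {x y : Fin (m + 2) → ℝ} (hxy : y ∘ Fin.succ = x ∘ Fin.succ)
    (j : Fin m) : logRatio y j.succ = logRatio x j.succ := by
  change logRatio (y ∘ Fin.succ) j = logRatio (x ∘ Fin.succ) j
  rw [hxy]

/-- Along the ray all log ratios but the one at `0` are fixed, and an invertible minor suffices to
bound `z` within the layer. -/
theorem IsLogQuasilinear.finite_rayCrossing {m : ℕ} {a : (Fin (m + 1) → ℤ) → Fin (m + 2) → ℝ}
    {M : Matrix (Fin (m + 1)) (Fin (m + 1)) ℝ} {K : ℝ} (h : IsLogQuasilinear a M K)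
    (hM : (M.submatrix Fin.succ Fin.succ).det ≠ 0) (x : Fin (m + 2) → ℝ) (k : ℤ)
    (σ : Equiv.Perm (Fin (m + 1))) :
    (Function.support fun z => rayCrossing a x (layerFace k z σ)).Finite := by
  set B := ∑ j : Fin (m + 1), |logRatio x j|
  refine (finite_setOf_abs_mulVec_le hM
    (B + kuhnBound M K + (∑ i, |M i 0|) * |(k : ℝ)|)).subset ?_
  intro z hz j
  obtain ⟨y, hy, hyx, -⟩ :=
    (mem_openCone_cons_neg_single _ _).1 (mem_openCone_of_signedCone_ne_zero hz)
  have h1 := h.abs_mulVec_layer_le hy j.succ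
  rw [logRatio_succ_eq hyx, mulVec_cons_succ] at h1
  have h2 := abs_mul_intCast_le_sum M k j.succ
  have h3 : |logRatio x j.succ| ≤ B := Finset.single_le_sum
    (f := fun j => |logRatio x j|) (fun i _ => abs_nonneg _) (Finset.mem_univ j.succ)
  rw [abs_le] at *
  constructor <;> linarith

/-- Points of cones in a far layer lie on a prescribed side of `x` on the line through `x` in
direction `e 0`. -/
theorem IsLogQuasilinear.exists_forall_layer {m : ℕ} {a : (Fin (m + 1) → ℤ) → Fin (m + 2) → ℝ}
    {M : Matrix (Fin (m + 1)) (Fin (m + 1)) ℝ} {K : ℝ} (h : IsLogQuasilinear a M K)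
    (hM : M.det ≠ 0) (hM0 : M⁻¹ 0 0 ≠ 0) {x : Fin (m + 2) → ℝ} (hx : ∀ j, 0 < x j) :
    ∃ N : ℝ, ∀ (k : ℤ) (z : Fin m → ℤ) (σ : Equiv.Perm (Fin (m + 1))),
      ∀ y ∈ openCone (a ∘ layerFace k z σ), y ∘ Fin.succ = x ∘ Fin.succ →
        (N < k / M⁻¹ 0 0 → x 0 < y 0) ∧ (k / M⁻¹ 0 0 < -N → y 0 < x 0) := by
  set B := (∑ j : Fin (m + 1), |logRatio x j|) + kuhnBound M K
  set C := ∑ j : Fin m, |M⁻¹ 0 j.succ| * B with hC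
  set d := M⁻¹ 0 0 with hd
  -- On the fibre, `w j` is bounded for `j ≠ 0`. Row `0` of `M⁻¹` gives `k = d * w 0 + O(1)`, so `w
  -- 0` is within `C / |d|` of `k / d`; the `B` covers the remaining errors in `logRatio y 0` and
  -- `logRatio x 0`.
  refine ⟨C / |d| + B, fun k z σ y hy hyx => ?_⟩
  set w := M.mulVec (fun p => ((Fin.cons k z : Fin (m + 1) → ℤ) p : ℝ)) with hw
  have hyw : ∀ j, |logRatio y j - w j| ≤ kuhnBound M K := h.abs_mulVec_layer_le hy
  have hle : ∀ j, |logRatio x j| ≤ ∑ j : Fin (m + 1), |logRatio x j| := fun j =>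
    Finset.single_le_sum (f := fun j => |logRatio x j|) (fun i _ => abs_nonneg _)
      (Finset.mem_univ j)
  have hwj : ∀ j : Fin m, |w j.succ| ≤ B := by
    intro j
    have h1 := hyw j.succ
    have h2 := hle j.succ
    rw [logRatio_succ_eq hyx] at h1
    rw [abs_le] at *
    constructor <;> linarith
  have hk : (k : ℝ) = d * w 0 + ∑ j : Fin m, M⁻¹ 0 j.succ * w j.succ := by
    have : M⁻¹.mulVec w 0 = k := by
      rw [hw, Matrix.mulVec_mulVec, Matrix.nonsing_inv_mul _ (isUnit_iff_ne_zero.2 hM),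
        Matrix.one_mulVec]
      rfl
    rw [← this, Matrix.mulVec, dotProduct, Fin.sum_univ_succ]
  have hkw : |k / d - w 0| ≤ C / |d| := by
    have : k / d - w 0 = (∑ j : Fin m, M⁻¹ 0 j.succ * w j.succ) / d := by
      rw [hk]; field_simp; ring
    rw [this, abs_div]
    refine div_le_div_of_nonneg_right ?_ (abs_nonneg _)
    refine (Finset.abs_sum_le_sum_abs _ _).trans (Finset.sum_le_sum fun j _ => ?_)
    rw [abs_mul]
    exact mul_le_mul_of_nonneg_left (hwj j) (abs_nonneg _)
  have hypos : ∀ j, 0 < y j := openCone_pos (fun i j => h.pos _ j) hy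
  have hlast : y (Fin.last (m + 1)) = x (Fin.last (m + 1)) := congrFun hyx (Fin.last m)
  have h0 := hyw 0
  have h1 := hle 0
  have hlx : logRatio x 0 = Real.log (x 0) - Real.log (x (Fin.last (m + 1))) := rfl
  have hly : logRatio y 0 = Real.log (y 0) - Real.log (x (Fin.last (m + 1))) := by
    rw [← hlast]; rfl
  rw [abs_le] at hkw h0 h1
  constructor
  · intro hN
    rw [← Real.log_lt_log_iff (hx 0) (hypos 0)]
    linarith
  · intro hN
    rw [← Real.log_lt_log_iff (hypos 0) (hx 0)]
    linarith

/-- The total intersection number of the ray from `x` in direction `e 0` with the cones on the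
simplices in the layer `z 0 = k`. -/
def layerCrossing {m : ℕ} (a : (Fin (m + 1) → ℤ) → Fin (m + 2) → ℝ) (x : Fin (m + 2) → ℝ)
    (k : ℤ) : ℤ :=
  ∑ σ : Equiv.Perm (Fin (m + 1)), if σ 0 = 0 then (Equiv.Perm.sign σ : ℤ) *
    ∑ᶠ z, rayCrossing a x (layerFace k z σ) else 0

theorem layerCrossing_eq {m : ℕ} (a : (Fin (m + 1) → ℤ) → Fin (m + 2) → ℝ)
    (x : Fin (m + 2) → ℝ) (k : ℤ) :
    layerCrossing a x k = ∑ τ : Equiv.Perm (Fin m), (Equiv.Perm.sign τ : ℤ) *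
      ∑ᶠ z, rayCrossing a x (fun i => Fin.cons k (kuhnVertex z τ i)) := by
  rw [layerCrossing, ← Equiv.sum_comp Equiv.Perm.decomposeFin.symm, Fintype.sum_prod_type,
    Fin.sum_univ_succ]
  have h2 : ∑ p : Fin m, ∑ τ : Equiv.Perm (Fin m),
      (if Equiv.Perm.decomposeFin.symm (p.succ, τ) 0 = 0 then
        (Equiv.Perm.sign (Equiv.Perm.decomposeFin.symm (p.succ, τ)) : ℤ) *
        ∑ᶠ z, rayCrossing a x (layerFace k z (Equiv.Perm.decomposeFin.symm (p.succ, τ)))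
        else 0) = 0 := by
    refine Finset.sum_eq_zero fun p _ => Finset.sum_eq_zero fun τ _ => if_neg ?_
    simp
  rw [h2, add_zero]
  refine Finset.sum_congr rfl fun τ _ => ?_
  have h3 : ∀ z, layerFace k z (Equiv.Perm.decomposeFin.symm (0, τ)) =
      fun i => Fin.cons k (kuhnVertex z τ i) := fun z =>
    funext fun i => kuhnVertex_cons_decomposeFin k z τ i
  rw [if_pos (by simp), Equiv.Perm.decomposeFin.symm_sign]
  simp [h3]

/-- Opposite cube faces differ by the shift `e (σ 0)`. For `σ 0 ≠ 0` this shift permutes the lattice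
points of the layer, so the two sums cancel; for `σ 0 = 0` it leads from layer `k` to layer `k + 1`.
-/
theorem sum_layer_eq_sub {m : ℕ} {a : (Fin (m + 1) → ℤ) → Fin (m + 2) → ℝ}
    {x : Fin (m + 2) → ℝ}
    (hfin : ∀ k σ, (Function.support fun z => rayCrossing a x (layerFace k z σ)).Finite)
    (hface : ∀ z σ, signedCone (fun i => a (kuhnVertex z σ i)) x =
      ∑ i : Fin (m + 2), (-1 : ℤ) ^ (i : ℕ) * rayCrossing a x (kuhnVertex z σ ∘ i.succAbove))
    (k : ℤ) :
    ∑ᶠ z : Fin m → ℤ, ∑ σ : Equiv.Perm (Fin (m + 1)), (Equiv.Perm.sign σ : ℤ) *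
      signedCone (fun i => a (kuhnVertex (Fin.cons k z) σ i)) x =
    layerCrossing a x (k + 1) - layerCrossing a x k := by
  have hshift0 : ∀ z : Fin m → ℤ, (Fin.cons k z : Fin (m + 1) → ℤ) + Pi.single 0 1 =
      Fin.cons (k + 1) z := by
    intro z
    ext p
    induction p using Fin.cases <;> simp
  have hshift : ∀ (z : Fin m → ℤ) (q : Fin m),
      (Fin.cons k z : Fin (m + 1) → ℤ) + Pi.single q.succ 1 =
        Fin.cons k (z + Pi.single q 1) := by
    intro z q
    ext p
    induction p using Fin.cases <;> simp [Pi.single_apply]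
  let f : (Fin m → ℤ) → Equiv.Perm (Fin (m + 1)) → ℤ := fun z σ =>
    rayCrossing a x (fun i => kuhnVertex ((Fin.cons k z : Fin (m + 1) → ℤ) + Pi.single (σ 0) 1)
      (σ * finRotate (m + 1)) i.castSucc)
  have hf : ∀ σ, (Function.support fun z => f z σ).Finite ∧
      ∑ᶠ z, f z σ = ∑ᶠ z, rayCrossing a x (layerFace (if σ 0 = 0 then k + 1 else k) z σ) := by
    intro σ
    by_cases h0 : σ 0 = 0
    · have : ∀ z, f z σ = rayCrossing a x (layerFace (k + 1) z σ) := by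
        intro z
        simp only [f, h0, hshift0]
        rfl
      simp only [this, if_pos h0]
      exact ⟨hfin _ _, trivial⟩
    · obtain ⟨q, hq⟩ := Fin.exists_succ_eq.2 h0
      have : (fun z => f z σ) =
          (fun z => rayCrossing a x (layerFace k z σ)) ∘ Equiv.addRight (Pi.single q 1 : Fin m → ℤ) := by
        funext z
        simp only [f, ← hq, hshift]
        rfl
      simp only [if_neg h0]
      constructor
      · rw [this, Function.support_comp_eq_preimage]
        exact (hfin k σ).preimage (Equiv.injective _).injOn
      · rw [this]
        exact finsum_comp_equiv (f := fun z => rayCrossing a x (layerFace k z σ))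
          (Equiv.addRight (Pi.single q 1 : Fin m → ℤ))
  have hstep : ∀ z : Fin m → ℤ, ∑ σ : Equiv.Perm (Fin (m + 1)), (Equiv.Perm.sign σ : ℤ) *
      signedCone (fun i => a (kuhnVertex (Fin.cons k z) σ i)) x =
      ∑ σ : Equiv.Perm (Fin (m + 1)), (Equiv.Perm.sign σ : ℤ) *
        (f z σ - rayCrossing a x (layerFace k z σ)) := by
    intro z
    simp only [hface]
    exact sum_sign_mul_sum_face (Fin.cons k z) (rayCrossing a x)
  rw [finsum_congr hstep, finsum_sum_comm]
  · rw [layerCrossing, layerCrossing, ← Finset.sum_sub_distrib]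
    refine Finset.sum_congr rfl fun σ _ => ?_
    rw [← mul_finsum, finsum_sub_distrib (hf σ).1 (hfin k σ), (hf σ).2]
    by_cases h0 : σ 0 = 0
    · simp only [if_pos h0]
      ring
    · simp only [if_neg h0, sub_self, mul_zero]
  · intro σ _
    refine ((hf σ).1.union (hfin k σ)).subset ?_
    exact (Function.support_mul_subset_right _ _).trans (Function.support_sub _ _)

theorem IsLogQuasilinear.finite_signedCone {m : ℕ} {a : (Fin m → ℤ) → Fin (m + 1) → ℝ}
    {M : Matrix (Fin m) (Fin m) ℝ} {K : ℝ} (h : IsLogQuasilinear a M K) (hM : M.det ≠ 0)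
    (x : Fin (m + 1) → ℝ) (σ : Equiv.Perm (Fin m)) :
    (Function.support fun z => signedCone (fun i => a (kuhnVertex z σ i)) x).Finite := by
  refine (h.finite_setOf_mem_openCone hM (∑ j, |logRatio x j|)).subset fun z hz =>
    ⟨σ, x, fun j => ?_, mem_openCone_of_signedCone_ne_zero hz⟩
  exact Finset.single_le_sum (f := fun j => |logRatio x j|) (fun i _ => abs_nonneg _)
    (Finset.mem_univ j)

theorem IsLogQuasilinear.kuhnSum_eq_finsum {m : ℕ} {a : (Fin m → ℤ) → Fin (m + 1) → ℝ}
    {M : Matrix (Fin m) (Fin m) ℝ} {K : ℝ} (h : IsLogQuasilinear a M K) (hM : M.det ≠ 0)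
    (x : Fin (m + 1) → ℝ) :
    (Function.support fun z => ∑ σ : Equiv.Perm (Fin m), (Equiv.Perm.sign σ : ℤ) *
      signedCone (fun i => a (kuhnVertex z σ i)) x).Finite ∧
    kuhnSum a x = ∑ᶠ z : Fin m → ℤ, ∑ σ : Equiv.Perm (Fin m), (Equiv.Perm.sign σ : ℤ) *
      signedCone (fun i => a (kuhnVertex z σ i)) x := by
  have hfin : ∀ σ : Equiv.Perm (Fin m), (Function.support fun z => (Equiv.Perm.sign σ : ℤ) *
      signedCone (fun i => a (kuhnVertex z σ i)) x).Finite := fun σ =>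
    (h.finite_signedCone hM x σ).subset (Function.support_mul_subset_right _ _)
  constructor
  · refine (Set.finite_iUnion hfin).subset fun z hz => ?_
    obtain ⟨σ, -, hσ⟩ := Finset.exists_ne_zero_of_sum_ne_zero hz
    exact Set.mem_iUnion.2 ⟨σ, hσ⟩
  · rw [finsum_sum_comm _ _ fun σ _ => hfin σ, kuhnSum]
    simp only [← mul_finsum]

theorem IsLogQuasilinear.kuhnSum_eq_finsum_layer {m : ℕ}
    {a : (Fin (m + 1) → ℤ) → Fin (m + 2) → ℝ}
    {M : Matrix (Fin (m + 1)) (Fin (m + 1)) ℝ} {K : ℝ} (h : IsLogQuasilinear a M K)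
    (hM : M.det ≠ 0) (hM' : (M.submatrix Fin.succ Fin.succ).det ≠ 0) {x : Fin (m + 2) → ℝ}
    (hface : ∀ z σ, signedCone (fun i => a (kuhnVertex z σ i)) x =
      ∑ i : Fin (m + 2), (-1 : ℤ) ^ (i : ℕ) * rayCrossing a x (kuhnVertex z σ ∘ i.succAbove)) :
    kuhnSum a x = ∑ᶠ k : ℤ, (layerCrossing a x (k + 1) - layerCrossing a x k) := by
  obtain ⟨hfin, hsum⟩ := h.kuhnSum_eq_finsum hM x
  let e : ℤ × (Fin m → ℤ) ≃ (Fin (m + 1) → ℤ) := Fin.consEquiv fun _ => ℤ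
  rw [hsum, ← finsum_comp_equiv e, finsum_curry]
  · refine finsum_congr fun k => ?_
    rw [← sum_layer_eq_sub (h.finite_rayCrossing hM' x) hface k]
    rfl
  · exact hfin.preimage e.injective.injOn

/-! ### The degree theorem at generic points. -/

theorem inv_apply_zero_zero {m : ℕ} (M : Matrix (Fin (m + 1)) (Fin (m + 1)) ℝ) :
    M⁻¹ 0 0 = (M.submatrix Fin.succ Fin.succ).det / M.det := by
  rw [Matrix.inv_def, Matrix.smul_apply, Matrix.adjugate_fin_succ_eq_det_submatrix]
  simp [div_eq_inv_mul]

/-- Genericity survives projection along `e 0` because the vectors to be avoided include `-e 0`,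
which can correct the lost coordinate. -/
theorem span_comp_succ {m n : ℕ} {x : Fin (m + 1) → ℝ} {s : Fin n → Fin (m + 1) → ℝ}
    (h : x ∘ Fin.succ ∈ Submodule.span ℝ (Set.range fun i => s i ∘ Fin.succ)) :
    x ∈ Submodule.span ℝ (Set.range
      (Fin.cons (-Pi.single 0 1) s : Fin (n + 1) → Fin (m + 1) → ℝ)) := by
  obtain ⟨c, hc⟩ := (Submodule.mem_span_range_iff_exists_fun ℝ).1 h
  refine (Submodule.mem_span_range_iff_exists_fun ℝ).2
    ⟨Fin.cons ((∑ i, c i • s i) 0 - x 0) c, ?_⟩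
  rw [Fin.sum_univ_succ]
  simp only [Fin.cons_zero, Fin.cons_succ]
  ext j
  induction j using Fin.cases with
  | zero => simp
  | succ j => simpa using congrFun hc j

/-- The degree theorem in the case where the first coordinate of the lattice is transversal to the
direction `e 0`, assuming the degree theorem in one dimension less. -/
theorem IsLogQuasilinear.kuhnSum_step {m : ℕ} {a : (Fin (m + 1) → ℤ) → Fin (m + 2) → ℝ}
    {M : Matrix (Fin (m + 1)) (Fin (m + 1)) ℝ} {K : ℝ} (h : IsLogQuasilinear a M K)
    (hM : M.det ≠ 0) (hM' : (M.submatrix Fin.succ Fin.succ).det ≠ 0) {x : Fin (m + 2) → ℝ}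
    (hx : ∀ j, 0 < x j)
    (hface : ∀ z σ, signedCone (fun i => a (kuhnVertex z σ i)) x =
      ∑ i : Fin (m + 2), (-1 : ℤ) ^ (i : ℕ) * rayCrossing a x (kuhnVertex z σ ∘ i.succAbove))
    (hlayer : ∀ k : ℤ, kuhnSum (fun z => a (Fin.cons k z) ∘ Fin.succ) (x ∘ Fin.succ) =
      (-1) ^ m * (SignType.sign (M.submatrix Fin.succ Fin.succ).det : ℤ)) :
    kuhnSum a x = (-1) ^ (m + 1) * (SignType.sign M.det : ℤ) := by
  have hd : M⁻¹ 0 0 = (M.submatrix Fin.succ Fin.succ).det / M.det := inv_apply_zero_zero M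
  set d := M⁻¹ 0 0
  have hd0 : d ≠ 0 := by
    rw [hd]
    exact div_ne_zero hM' hM
  obtain ⟨N, hN⟩ := h.exists_forall_layer hM hd0 hx
  have hface' : ∀ (k : ℤ) (z : Fin m → ℤ) (τ : Equiv.Perm (Fin m)),
      (fun i => Fin.cons k (kuhnVertex z τ i)) =
        layerFace k z (Equiv.Perm.decomposeFin.symm (0, τ)) := fun k z τ =>
    funext fun i => (kuhnVertex_cons_decomposeFin k z τ i).symm
  have hpos : ∀ k : ℤ, N < k / d → layerCrossing a x k =
      -((-1) ^ m * (SignType.sign (M.submatrix Fin.succ Fin.succ).det : ℤ)) := by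
    intro k hk
    rw [← hlayer k, layerCrossing_eq, kuhnSum, ← Finset.sum_neg_distrib]
    refine Finset.sum_congr rfl fun τ _ => ?_
    rw [← mul_neg, ← finsum_neg_distrib]
    congr 1
    refine finsum_congr fun z => ?_
    refine signedCone_cons_of_lt fun y hy hyx => ?_
    rw [hface'] at hy
    exact (hN k z _ y hy hyx).1 hk
  have hneg : ∀ k : ℤ, k / d < -N → layerCrossing a x k = 0 := by
    intro k hk
    rw [layerCrossing_eq]
    refine Finset.sum_eq_zero fun τ _ => ?_
    rw [finsum_eq_zero_of_forall_eq_zero, mul_zero]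
    intro z
    refine signedCone_cons_of_gt fun y hy hyx => ?_
    rw [hface'] at hy
    exact (hN k z _ y hy hyx).2 hk
  rw [h.kuhnSum_eq_finsum_layer hM hM' hface]
  obtain ⟨n, hn⟩ := exists_int_gt (N * |d|)
  have hsign : (SignType.sign d : ℤ) * (SignType.sign M.det : ℤ) =
      (SignType.sign (M.submatrix Fin.succ Fin.succ).det : ℤ) := by
    have : (M.submatrix Fin.succ Fin.succ).det = d * M.det := by
      rw [hd]; field_simp
    rw [this, sign_mul]
    simp
  -- The sign of `d` decides at which end of the `k`-axis the layers lie beyond `x`, hence the sign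
  -- of the telescoped difference.
  rcases lt_or_gt_of_ne hd0 with hneg0 | hpos0
  · rw [abs_of_neg hneg0] at hn
    rw [finsum_sub_of_eventually_const (N := n)
      (fun k hk => hneg k ?_) (fun k hk => hpos k ?_), ← hsign, sign_neg hneg0]
    · push_cast [SignType.coe_one]; ring
    · have hk' : (n : ℝ) ≤ k := by exact_mod_cast hk
      rw [div_lt_iff_of_neg hneg0]
      linarith
    · have hk' : (k : ℝ) ≤ -n := by exact_mod_cast hk
      rw [lt_div_iff_of_neg hneg0]
      linarith
  · rw [abs_of_pos hpos0] at hn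
    rw [finsum_sub_of_eventually_const (N := n)
      (fun k hk => hpos k ?_) (fun k hk => hneg k ?_), ← hsign, sign_pos hpos0]
    · push_cast [SignType.coe_one]; ring
    · have hk' : (n : ℝ) ≤ k := by exact_mod_cast hk
      rw [lt_div_iff₀ hpos0]
      linarith
    · have hk' : (k : ℝ) ≤ -n := by exact_mod_cast hk
      rw [div_lt_iff₀ hpos0]
      linarith

theorem kuhnSum_zero (a : (Fin 0 → ℤ) → Fin 1 → ℝ) (ha : ∀ z i, 0 < a z i) (x : Fin 1 → ℝ)
    (hx : ∀ j, 0 < x j) : kuhnSum a x = 1 := by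
  have hmem : ∀ z σ, x ∈ openCone fun i => a (kuhnVertex z σ i) := by
    intro z σ
    refine ⟨fun _ => x 0 / a (kuhnVertex z σ 0) 0, fun _ => div_pos (hx 0) (ha _ _), ?_⟩
    ext j
    rw [Subsingleton.elim j 0]
    have := (ha (kuhnVertex z σ 0) 0).ne'
    simp [this]
  have hone : ∀ z σ, signedCone (fun i => a (kuhnVertex z σ i)) x = 1 := by
    intro z σ
    rw [signedCone, if_pos (hmem z σ), Matrix.det_fin_one, Matrix.of_apply, sign_pos (ha _ _)]
    rfl
  rw [kuhnSum, Fintype.sum_unique, finsum_unique, hone]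
  simp

/-- The degree theorem: the simplices of the Kuhn triangulation, mapped to positive cones by a map
which is logarithmically at bounded distance from a linear isomorphism, cover every sufficiently
generic positive vector once when counted with signs. -/
theorem IsLogQuasilinear.kuhnSum_eq {m : ℕ} {a : (Fin m → ℤ) → Fin (m + 1) → ℝ}
    {M : Matrix (Fin m) (Fin m) ℝ} {K : ℝ} (h : IsLogQuasilinear a M K) (hM : M.det ≠ 0)
    {S : Set (Fin (m + 1) → ℝ)} (haS : ∀ z, a z ∈ S) (heS : ∀ j, -Pi.single j 1 ∈ S)
    {x : Fin (m + 1) → ℝ} (hx : ∀ j, 0 < x j)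
    (hgen : ∀ s : Fin m → Fin (m + 1) → ℝ, (∀ i, s i ∈ S) →
      x ∉ Submodule.span ℝ (Set.range s)) :
    kuhnSum a x = (-1) ^ m * (SignType.sign M.det : ℤ) := by
  induction m generalizing K with
  | zero =>
    rw [kuhnSum_zero a h.pos x hx, Matrix.det_fin_zero]
    simp
  | succ m ih =>
    have key : ∀ {a : (Fin (m + 1) → ℤ) → Fin (m + 2) → ℝ}
        {M : Matrix (Fin (m + 1)) (Fin (m + 1)) ℝ}, IsLogQuasilinear a M K → M.det ≠ 0 →
        (M.submatrix Fin.succ Fin.succ).det ≠ 0 → (∀ z, a z ∈ S) →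
        kuhnSum a x = (-1) ^ (m + 1) * (SignType.sign M.det : ℤ) := by
      intro a M h hM hM' haS
      refine h.kuhnSum_step hM hM' hx (fun z σ => ?_) fun k => ?_
      · refine signedCone_eq_sum_faces _ (fun i j => h.pos _ j) x fun s => hgen _ fun i => ?_
        simp only [Function.comp_apply]
        generalize s i = j
        induction j using Fin.cases with
        | zero => exact heS 0
        | succ j => exact haS _
      · refine ih (h.layer k) hM' (S := (fun y => y ∘ Fin.succ) '' S)
          (fun z => ⟨_, haS _, rfl⟩) (fun j => ⟨_, heS j.succ, ?_⟩) (fun j => hx _)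
          fun s hs hmem => ?_
        · ext i
          simp [Pi.single_apply]
        · choose t ht hts using hs
          refine hgen (Fin.cons (-Pi.single 0 1) t) (fun i => ?_) (span_comp_succ ?_)
          · induction i using Fin.cases with
            | zero => exact heS 0
            | succ i => exact ht i
          · convert hmem using 3
            funext i
            exact hts i
    obtain ⟨p, hp⟩ : ∃ p : Fin (m + 1), (M.submatrix Fin.succ p.succAbove).det ≠ 0 := by
      by_contra! hcon
      apply hM
      rw [Matrix.det_succ_row_zero]
      simp [hcon]
    -- Relabelling the lattice coordinates moves column `p` to the front, making the leading minor
    -- nonzero. The count and `det M` both change by the sign of `g`.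
    set g : Equiv.Perm (Fin (m + 1)) := p.cycleRange
    have hdet : (M.submatrix id g.symm).det = (Equiv.Perm.sign g : ℤ) * M.det := by
      rw [Matrix.det_permute', Equiv.Perm.sign_symm]
    have h1 := key (h.comp_perm g) ?_ ?_ (fun z => haS _)
    · rw [kuhnSum_comp_perm, hdet, sign_mul] at h1
      rcases Int.units_eq_one_or (Equiv.Perm.sign g) with hg | hg
      · simpa [hg] using h1
      · simpa [hg, Left.sign_neg] using h1
    · rw [hdet]
      refine mul_ne_zero ?_ hM
      exact_mod_cast (Equiv.Perm.sign g).ne_zero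
    · convert hp using 2
      ext i j
      simp [g]

/-! ### From generic points to all points by perturbation. -/

theorem mem_openCone_iff_repr_pos {ι E : Type*} [Fintype ι] [AddCommGroup E] [Module ℝ E]
    (b : Module.Basis ι ℝ E) (x : E) : x ∈ openCone b ↔ ∀ i, 0 < b.repr x i := by
  constructor
  · rintro ⟨c, hc, rfl⟩ i
    rw [b.repr_sum_self]
    exact hc i
  · intro h
    exact ⟨b.repr x, h, (b.sum_repr x).symm⟩

/-- Off the walls no coordinate in the basis `V` vanishes, so all their signs are locally constant.
-/
theorem eventually_mem_openCone_iff {k : ℕ} {V : Fin (k + 1) → Fin (k + 1) → ℝ}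
    (hV : LinearIndependent ℝ V) {y : Fin (k + 1) → ℝ}
    (hy : ∀ i : Fin (k + 1), y ∉ Submodule.span ℝ (Set.range (V ∘ i.succAbove))) :
    ∀ᶠ y' in 𝓝 y, (y' ∈ openCone V ↔ y ∈ openCone V) := by
  let b := basisOfLinearIndependentOfCardEqFinrank hV (by simp)
  have hb : ⇑b = V := coe_basisOfLinearIndependentOfCardEqFinrank hV (by simp)
  have hcont : ∀ i, Continuous fun y' => b.repr y' i := fun i =>
    (b.coord i).continuous_of_finiteDimensional
  have hne : ∀ i, b.repr y i ≠ 0 := by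
    intro i hi
    apply hy i
    rw [← b.sum_repr y, Fin.sum_univ_succAbove _ i, hi, zero_smul, zero_add, hb]
    exact Submodule.sum_mem _ fun r _ => Submodule.smul_mem _ _ (Submodule.subset_span ⟨r, rfl⟩)
  have hsign : ∀ i, ∀ᶠ y' in 𝓝 y, (0 < b.repr y' i ↔ 0 < b.repr y i) := by
    intro i
    rcases lt_or_gt_of_ne (hne i) with h | h
    · filter_upwards [(hcont i).continuousAt.eventually_lt_const h] with y' hy'
      simp [h.not_gt, hy'.not_gt]
    · filter_upwards [(hcont i).continuousAt.eventually_const_lt h] with y' hy'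
      simp [h, hy']
  filter_upwards [Filter.eventually_all.2 hsign] with y' hy'
  rw [← hb, mem_openCone_iff_repr_pos, mem_openCone_iff_repr_pos]
  exact forall_congr' hy'

theorem eventually_signedCone_eq {k : ℕ} {V : Fin (k + 1) → Fin (k + 1) → ℝ}
    {y : Fin (k + 1) → ℝ}
    (hy : ∀ i : Fin (k + 1), y ∉ Submodule.span ℝ (Set.range (V ∘ i.succAbove))) :
    ∀ᶠ y' in 𝓝 y, signedCone V y' = signedCone V y := by
  by_cases hdet : (Matrix.of V).det = 0
  · simp [signedCone, hdet]
  · filter_upwards [eventually_mem_openCone_iff (linearIndependent_of_det_ne_zero hdet) hy]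
      with y' hy'
    by_cases hm : y ∈ openCone V
    · simp [signedCone, hm, hy'.2 hm]
    · simp [signedCone, hm, mt hy'.1 hm]

/-- The bad points lie in countably many proper subspaces, a null set, whose complement is dense. -/
theorem exists_generic {m : ℕ} {S : Set (Fin (m + 1) → ℝ)} (hS : S.Countable)
    {y : Fin (m + 1) → ℝ} {p : (Fin (m + 1) → ℝ) → Prop} (hp : ∀ᶠ y' in 𝓝 y, p y') :
    ∃ y', p y' ∧ ∀ s : Fin m → Fin (m + 1) → ℝ, (∀ i, s i ∈ S) →
      y' ∉ Submodule.span ℝ (Set.range s) := by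
  have : Countable S := hS
  have hae : ∀ᵐ y' : Fin (m + 1) → ℝ, ∀ s : Fin m → S,
      y' ∉ Submodule.span ℝ (Set.range fun i => (s i : Fin (m + 1) → ℝ)) := by
    rw [MeasureTheory.ae_all_iff]
    intro s
    have hne : Submodule.span ℝ (Set.range fun i => (s i : Fin (m + 1) → ℝ)) ≠ ⊤ := by
      intro htop
      have h1 := finrank_range_le_card (R := ℝ) fun i => (s i : Fin (m + 1) → ℝ)
      rw [Set.finrank, htop, finrank_top] at h1
      simp at h1
    exact MeasureTheory.measure_eq_zero_iff_ae_notMem.1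
      (MeasureTheory.Measure.addHaar_submodule MeasureTheory.volume _ hne)
  obtain ⟨y', hy', hgen⟩ :=
    (MeasureTheory.Measure.dense_of_ae hae).inter_nhds_nonempty hp
  exact ⟨y', hgen, fun s hs => hy' fun i => ⟨s i, hs i⟩⟩

/-- A line with direction outside `H` meets `H` at most once. -/
theorem eventually_add_smul_notMem {E : Type*} [AddCommGroup E] [Module ℝ E] {Q : E}
    {H : Submodule ℝ E} (hQ : Q ∉ H) (x : E) : ∀ᶠ ε : ℝ in 𝓝[>] 0, x + ε • Q ∉ H := by
  by_cases h : ∃ δ : ℝ, 0 < δ ∧ x + δ • Q ∈ H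
  · obtain ⟨δ, hδ, hδH⟩ := h
    filter_upwards [Ioo_mem_nhdsGT hδ] with ε hε hεH
    apply hQ
    have h1 : (δ - ε) • Q ∈ H := by
      have := H.sub_mem hδH hεH
      rwa [add_sub_add_left_eq_sub, ← sub_smul] at this
    exact (H.smul_mem_iff (sub_pos.2 hε.2).ne').1 h1
  · filter_upwards [self_mem_nhdsWithin] with ε hε hεH
    exact h ⟨ε, hε, hεH⟩

theorem eventually_pos_and_logRatio_le {m : ℕ} {x : Fin (m + 1) → ℝ} (hx : ∀ j, 0 < x j) {B : ℝ}
    (hB : ∀ j, |logRatio x j| < B) :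
    ∀ᶠ y in 𝓝 x, (∀ j, 0 < y j) ∧ ∀ j, |logRatio y j| < B := by
  refine (Filter.eventually_all.2 fun j => ?_).and (Filter.eventually_all.2 fun j => ?_)
  · exact (continuous_apply j).continuousAt.eventually_const_lt (hx j)
  · have : ContinuousAt (fun y : Fin (m + 1) → ℝ => |logRatio y j|) x := by
      refine ContinuousAt.abs (ContinuousAt.sub ?_ ?_)
      · exact (continuous_apply j.castSucc).continuousAt.log (hx _).ne'
      · exact (continuous_apply (Fin.last m)).continuousAt.log (hx _).ne'
    exact this.eventually_lt_const (hB j)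

theorem tendsto_add_smul_nhdsGT {m : ℕ} (x Q : Fin m → ℝ) :
    Filter.Tendsto (fun ε : ℝ => x + ε • Q) (𝓝[>] 0) (𝓝 x) := by
  have : Continuous fun ε : ℝ => x + ε • Q := by fun_prop
  have h := this.tendsto 0
  rw [zero_smul, add_zero] at h
  exact h.mono_left nhdsWithin_le_nhds

theorem eventually_signedCone_add_smul_eq {k : ℕ} (Q : Fin k → ℝ) (V : Fin k → Fin k → ℝ)
    (x : Fin k → ℝ) : ∀ᶠ ε : ℝ in 𝓝[>] 0, signedCone V (x + ε • Q) =
      (SignType.sign (Matrix.of V).det : ℤ) * perturbedConeFun Q V x := by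
  by_cases hdet : (Matrix.of V).det = 0
  · simp [signedCone, hdet]
  · have h := tendsto_perturbedConeFun Q V (linearIndependent_of_det_ne_zero hdet) x
    rw [nhds_discrete, Filter.tendsto_pure] at h
    filter_upwards [h] with ε hε
    rw [← hε, signedCone]
    by_cases hm : x + ε • Q ∈ openCone V
    · simp [hm]
    · simp [hm]

/-- The degree theorem for arbitrary positive vectors, with the boundary of the cones counted
according to a perturbation in direction `Q`. -/
theorem IsLogQuasilinear.finsum_perturbedConeFun {m : ℕ} {a : (Fin m → ℤ) → Fin (m + 1) → ℝ}
    {M : Matrix (Fin m) (Fin m) ℝ} {K : ℝ} (h : IsLogQuasilinear a M K) (hM : M.det ≠ 0)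
    {Q : Fin (m + 1) → ℝ}
    (hQ : ∀ t : Fin m → Fin m → ℤ, Q ∉ Submodule.span ℝ (Set.range (a ∘ t)))
    {x : Fin (m + 1) → ℝ} (hx : ∀ j, 0 < x j) :
    (Function.support fun z => ∑ σ : Equiv.Perm (Fin m), (Equiv.Perm.sign σ : ℤ) *
      ((SignType.sign (Matrix.of fun i => a (kuhnVertex z σ i)).det : ℤ) *
        perturbedConeFun Q (fun i => a (kuhnVertex z σ i)) x)).Finite ∧
    ∑ᶠ z, ∑ σ : Equiv.Perm (Fin m), (Equiv.Perm.sign σ : ℤ) *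
      ((SignType.sign (Matrix.of fun i => a (kuhnVertex z σ i)).det : ℤ) *
        perturbedConeFun Q (fun i => a (kuhnVertex z σ i)) x) =
      (-1) ^ m * (SignType.sign M.det : ℤ) := by
  -- The extra `1` makes the bound strict, hence valid near `x`, so one finite set `Z` serves all
  -- nearby points.
  set B := (∑ j, |logRatio x j|) + 1
  have hB : ∀ j, |logRatio x j| < B := fun j => lt_of_le_of_lt
    (Finset.single_le_sum (f := fun j => |logRatio x j|) (fun i _ => abs_nonneg _)
      (Finset.mem_univ j)) (lt_add_one _)
  have hZ := h.finite_setOf_mem_openCone hM B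
  set Z := {z | ∃ σ y, (∀ j, |logRatio y j| ≤ B) ∧
      y ∈ openCone fun i => a (kuhnVertex z σ i)} with hZdef
  have hnear := (tendsto_add_smul_nhdsGT x Q).eventually (eventually_pos_and_logRatio_le hx hB)
  have hout : ∀ z ∉ Z, ∀ σ, perturbedConeFun Q (fun i => a (kuhnVertex z σ i)) x = 0 := by
    intro z hz σ
    rw [perturbedConeFun, Set.indicator_of_notMem]
    rintro ⟨-, hcone⟩
    obtain ⟨ε, hε, -, hεB⟩ := (hcone.and hnear).exists
    exact hz ⟨σ, _, fun j => (hεB j).le, hε⟩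
  constructor
  · refine hZ.subset fun z hz => ?_
    by_contra hzZ
    exact hz (Finset.sum_eq_zero fun σ _ => by simp only [hout z hzZ σ, mul_zero])
  have e1 : ∀ᶠ ε : ℝ in 𝓝[>] 0, ∀ z ∈ Z, ∀ σ,
      signedCone (fun i => a (kuhnVertex z σ i)) (x + ε • Q) =
        (SignType.sign (Matrix.of fun i => a (kuhnVertex z σ i)).det : ℤ) *
          perturbedConeFun Q (fun i => a (kuhnVertex z σ i)) x :=
    (Filter.eventually_all_finite hZ).2 fun z _ => Filter.eventually_all.2 fun σ =>
      eventually_signedCone_add_smul_eq Q _ x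
  have e2 : ∀ᶠ ε : ℝ in 𝓝[>] 0, ∀ z ∈ Z, ∀ (σ : Equiv.Perm (Fin m)) (i : Fin (m + 1)),
      x + ε • Q ∉ Submodule.span ℝ
        (Set.range ((fun i => a (kuhnVertex z σ i)) ∘ i.succAbove)) :=
    (Filter.eventually_all_finite hZ).2 fun z _ => Filter.eventually_all.2 fun σ =>
      Filter.eventually_all.2 fun i => eventually_add_smul_notMem (hQ _) x
  -- Two moves are needed: `x + ε • Q` avoids the walls of the cones over `Z`, but may still lie in
  -- spans involving some `-e j`, which the degree theorem excludes.
  obtain ⟨ε, h1, h2, h3, h4⟩ := (e1.and (e2.and hnear)).exists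
  have e3 : ∀ᶠ y in 𝓝 (x + ε • Q), ∀ z ∈ Z, ∀ σ : Equiv.Perm (Fin m),
      signedCone (fun i => a (kuhnVertex z σ i)) y =
        signedCone (fun i => a (kuhnVertex z σ i)) (x + ε • Q) :=
    (Filter.eventually_all_finite hZ).2 fun z hz => Filter.eventually_all.2 fun σ =>
      eventually_signedCone_eq (h2 z hz σ)
  have hS : (Set.range a ∪ Set.range fun j : Fin (m + 1) => -(Pi.single j 1 : Fin (m + 1) → ℝ)
      ).Countable := (Set.countable_range _).union (Set.countable_range _)
  obtain ⟨y, ⟨hy1, hy2, hy3⟩, hgen⟩ :=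
    exists_generic hS (e3.and (eventually_pos_and_logRatio_le h3 h4))
  rw [← h.kuhnSum_eq hM (fun z => Or.inl ⟨z, rfl⟩) (fun j => Or.inr ⟨j, rfl⟩) hy2 hgen,
    (h.kuhnSum_eq_finsum hM y).2]
  refine finsum_congr fun z => Finset.sum_congr rfl fun σ _ => ?_
  by_cases hz : z ∈ Z
  · rw [hy1 z hz, h1 z hz]
  · rw [hout z hz, mul_zero, mul_zero, signedCone, if_neg, mul_zero]
    exact fun hy => hz ⟨σ, y, fun j => (hy3 j).le, hy⟩

/-! ### Formal sums of faces and their characteristic functions. -/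

section ConeFaces

variable {E : Type*} [AddCommGroup E] [Module ℝ E]

theorem FormalConeSum.charFun_add (D D' : FormalConeSum E) (w : E) :
    (D + D').charFun w = D.charFun w + D'.charFun w :=
  Finsupp.sum_add_index' (by simp) (by intros; rw [add_mul])

theorem FormalConeSum.charFun_single (C : OpenCone E) (k : ℤ) (w : E) :
    FormalConeSum.charFun (Finsupp.single C k) w =
      k * C.1.indicator (fun _ => (1 : ℤ)) w :=
  Finsupp.sum_single_index (by simp)

/-- Evaluation of the characteristic function as a homomorphism. -/
def FormalConeSum.charFunHom (w : E) : FormalConeSum E →+ ℤ where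
  toFun D := D.charFun w
  map_zero' := Finsupp.sum_zero_index
  map_add' D D' := D.charFun_add D' w

theorem FormalConeSum.charFun_sum_smul {ι : Type*} (s : Finset ι) (k : ι → ℤ)
    (D : ι → FormalConeSum E) (w : E) :
    FormalConeSum.charFun (∑ i ∈ s, k i • D i) w = ∑ i ∈ s, k i * (D i).charFun w := by
  change FormalConeSum.charFunHom w _ = _
  rw [map_sum]
  refine Finset.sum_congr rfl fun i _ => ?_
  rw [map_zsmul, smul_eq_mul]
  rfl

variable {ι : Type*} [Fintype ι]

theorem mem_coneFace_iff (v : ι → E) (hv : LinearIndependent ℝ v) (I : Finset ι) (w : E) :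
    w ∈ (coneFace v hv I).1 ↔
      ∃ c : ι → ℝ, w = ∑ i, c i • v i ∧ ∀ i, (i ∈ I → 0 < c i) ∧ (i ∉ I → c i = 0) := by
  classical
  constructor
  · rintro ⟨c, hc, rfl⟩
    refine ⟨fun i => if h : i ∈ I then c ⟨i, h⟩ else 0, ?_, fun i => ⟨fun hi => ?_, fun hi => ?_⟩⟩
    · rw [← Finset.sum_subset (Finset.subset_univ I) (fun i _ hi => by simp [hi]),
        ← Finset.sum_coe_sort I]
      refine Finset.sum_congr rfl fun i _ => ?_
      simp
    · simpa [hi] using hc _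
    · simp [hi]
  · rintro ⟨c, rfl, hc⟩
    refine ⟨fun i => c i, fun i => (hc i).1 i.2, ?_⟩
    rw [Finset.sum_coe_sort I fun i => c i • v i]
    exact (Finset.sum_subset (Finset.subset_univ I) fun i _ hi => by simp [(hc i).2 hi]).symm

theorem eventually_add_mul_pos_iff (c q : ℝ) :
    (∀ᶠ ε : ℝ in 𝓝[>] 0, 0 < c + ε * q) ↔ 0 < c ∨ c = 0 ∧ 0 < q := by
  constructor
  · intro h
    rcases lt_trichotomy c 0 with hc | hc | hc
    · have hcont : Filter.Tendsto (fun ε : ℝ => c + ε * q) (𝓝[>] 0) (𝓝 c) := by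
        have : Continuous fun ε : ℝ => c + ε * q := by fun_prop
        have h := this.tendsto 0
        rw [zero_mul, add_zero] at h
        exact h.mono_left nhdsWithin_le_nhds
      obtain ⟨ε, h1, h2⟩ := (h.and (hcont.eventually_lt_const hc)).exists
      exact absurd h1 h2.not_gt
    · obtain ⟨ε, h1, h2⟩ := (h.and self_mem_nhdsWithin).exists
      rw [hc, zero_add] at h1
      exact Or.inr ⟨hc, pos_of_mul_pos_right h1 (le_of_lt h2)⟩
    · exact Or.inl hc
  · rintro (hc | ⟨rfl, hq⟩)
    · have hcont : Filter.Tendsto (fun ε : ℝ => c + ε * q) (𝓝[>] 0) (𝓝 c) := by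
        have : Continuous fun ε : ℝ => c + ε * q := by fun_prop
        have h := this.tendsto 0
        rw [zero_mul, add_zero] at h
        exact h.mono_left nhdsWithin_le_nhds
      exact hcont.eventually_const_lt hc
    · filter_upwards [self_mem_nhdsWithin] with ε hε
      rw [zero_add]
      exact mul_pos hε hq

/-- Independence reduces the perturbation to one scalar condition per coefficient. -/
theorem sum_smul_mem_perturbedConeSet_iff {v : ι → E} (hv : LinearIndependent ℝ v) (c q : ι → ℝ) :
    ∑ i, c i • v i ∈ perturbedConeSet (∑ i, q i • v i) v ↔
      ∀ i, 0 < c i ∨ c i = 0 ∧ 0 < q i := by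
  have h1 : ∀ ε : ℝ, ∑ i, c i • v i + ε • ∑ i, q i • v i ∈ openCone v ↔
      ∀ i, 0 < c i + ε * q i := by
    intro ε
    have h2 : ∑ i, c i • v i + ε • ∑ i, q i • v i = ∑ i, (c i + ε * q i) • v i := by
      simp only [add_smul, Finset.sum_add_distrib, Finset.smul_sum, mul_smul]
    rw [h2]
    constructor
    · rintro ⟨d, hd, hcd⟩ i
      rw [Fintype.linearIndependent_iff.1 hv (fun i => c i + ε * q i - d i)
        (by simp only [sub_smul, Finset.sum_sub_distrib, hcd, sub_self]) i |> sub_eq_zero.1]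
      exact hd i
    · exact fun h => ⟨_, h, rfl⟩
  simp only [← eventually_add_mul_pos_iff, ← Filter.eventually_all, ← h1]
  exact ⟨fun h => h.2, fun h => ⟨hv, h⟩⟩

/-- The formal sum of cones `C_Q(v)` has characteristic function `c_Q(v)`. -/
theorem charFun_perturbedCone {Q : E} {v : ι → E} (hQ : LinearIndependent ℝ v →
    Q ∈ Submodule.span ℝ (Set.range v)) (w : E) :
    (perturbedCone Q v).charFun w = perturbedConeFun Q v w := by
  classical
  by_cases hv : LinearIndependent ℝ v
  swap
  · rw [perturbedCone, dif_neg hv, perturbedConeFun, Set.indicator_of_notMem fun h => hv h.1]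
    exact Finsupp.sum_zero_index
  obtain ⟨q, hq⟩ := (Submodule.mem_span_range_iff_exists_fun ℝ).1 (hQ hv)
  have hsum : (perturbedCone Q v).charFun w =
      ∑ I : Finset ι with (coneFace v hv I).1 ⊆ perturbedConeSet Q v,
        (coneFace v hv I).1.indicator (fun _ => (1 : ℤ)) w := by
    rw [perturbedCone, dif_pos hv]
    change FormalConeSum.charFunHom w _ = _
    rw [map_sum]
    refine Finset.sum_congr (Finset.filter_congr_decidable _ _ _) fun I _ => ?_
    exact (FormalConeSum.charFun_single _ _ _).trans (one_mul _)
  rw [hsum, perturbedConeFun]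
  by_cases hw : w ∈ perturbedConeSet Q v
  · rw [Set.indicator_of_mem hw]
    obtain ⟨c, rfl⟩ : ∃ c : ι → ℝ, w = ∑ i, c i • v i := by
      obtain ⟨ε, d, -, hd⟩ := hw.2.exists
      refine ⟨fun i => d i - ε * q i, ?_⟩
      simp only [sub_smul, Finset.sum_sub_distrib, mul_smul, ← Finset.smul_sum, hq, ← hd]
      simp
    have hc := hw
    rw [← hq, sum_smul_mem_perturbedConeSet_iff hv] at hc
    -- Faces are disjoint, so `w` lies only in the face of its positive coefficients. That face lies
    -- entirely in `C_Q(v)`, because its missing indices all have `q i > 0`.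
    have hmem : ∀ I : Finset ι, ∑ i, c i • v i ∈ (coneFace v hv I).1 ↔
        I = Finset.univ.filter fun i => 0 < c i := by
      intro I
      rw [mem_coneFace_iff]
      constructor
      · rintro ⟨d, hd, hdI⟩
        have hcd : ∀ i, c i = d i := fun i => sub_eq_zero.1 (Fintype.linearIndependent_iff.1 hv
          (fun i => c i - d i) (by simp only [sub_smul, Finset.sum_sub_distrib, hd, sub_self]) i)
        ext i
        simp only [Finset.mem_filter, Finset.mem_univ, true_and, hcd]
        refine ⟨(hdI i).1, fun h => ?_⟩
        by_contra hi
        exact h.ne' ((hdI i).2 hi)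
      · rintro rfl
        refine ⟨c, rfl, fun i => ⟨fun hi => by simpa using hi, fun hi => ?_⟩⟩
        rcases hc i with h | h
        · simp [h] at hi
        · exact h.1
    rw [Finset.sum_eq_single (Finset.univ.filter fun i => 0 < c i)]
    · exact Set.indicator_of_mem ((hmem _).2 rfl) _
    · exact fun I _ hI => Set.indicator_of_notMem (mt (hmem I).1 hI) _
    · intro hI
      refine absurd ?_ hI
      simp only [Finset.mem_filter, Finset.mem_univ, true_and]
      intro w' hw'
      obtain ⟨d, rfl, hd⟩ := (mem_coneFace_iff _ _ _ _).1 hw'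
      rw [← hq, sum_smul_mem_perturbedConeSet_iff hv]
      intro i
      by_cases hi : 0 < c i
      · exact Or.inl ((hd i).1 (by simpa using hi))
      · exact Or.inr ⟨(hd i).2 (by simpa using hi), ((hc i).resolve_left hi).2⟩
  · rw [Set.indicator_of_notMem hw]
    refine Finset.sum_eq_zero fun I hI => Set.indicator_of_notMem (fun h => hw ?_) _
    exact (Finset.mem_filter.1 hI).2 h

end ConeFaces

/-! ### Equivariance under the positive orthant. -/

theorem mem_openCone_map_iff {ι E : Type*} [Fintype ι] [AddCommGroup E] [Module ℝ E]
    (L : E ≃ₗ[ℝ] E) (v : ι → E) (w : E) : L w ∈ openCone (L ∘ v) ↔ w ∈ openCone v := by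
  refine exists_congr fun c => and_congr_right fun _ => ?_
  rw [← L.injective.eq_iff (a := w), map_sum]
  simp only [map_smul, Function.comp_apply]

/-- Scaling `Q` by `r > 0` only reparametrizes `ε`. Coordinate axes are eigenlines of componentwise
multiplication, so this applies to `e_n`. -/
theorem perturbedConeFun_map {ι E : Type*} [Fintype ι] [AddCommGroup E] [Module ℝ E]
    (L : E ≃ₗ[ℝ] E) {Q : E} {r : ℝ} (hr : 0 < r) (hQ : L Q = r • Q) (v : ι → E) (w : E) :
    perturbedConeFun Q (L ∘ v) (L w) = perturbedConeFun Q v w := by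
  have hmem : ∀ ε : ℝ, L w + ε • Q ∈ openCone (L ∘ v) ↔ w + (r⁻¹ * ε) • Q ∈ openCone v := by
    intro ε
    have h1 : L (w + (r⁻¹ * ε) • Q) = L w + ε • Q := by
      rw [map_add, map_smul, hQ, smul_smul]
      congr 2
      field_simp
    rw [← h1, mem_openCone_map_iff L v]
  have hmap : Filter.map (fun ε : ℝ => r⁻¹ * ε) (𝓝[>] 0) = 𝓝[>] 0 := by
    have hpre : (fun ε : ℝ => r⁻¹ * ε) ⁻¹' Set.Ioi 0 = Set.Ioi 0 := by
      ext ε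
      simp [hr]
    have h1 : Filter.map (fun ε : ℝ => r⁻¹ * ε) (𝓝[(fun ε : ℝ => r⁻¹ * ε) ⁻¹' Set.Ioi 0] 0) =
        𝓝[Set.Ioi 0] (r⁻¹ * 0) :=
      (Homeomorph.mulLeft₀ r⁻¹
        (inv_ne_zero hr.ne')).isOpenEmbedding.map_nhdsWithin_preimage_eq (Set.Ioi 0) 0
    rwa [hpre, mul_zero] at h1
  have hset : L w ∈ perturbedConeSet Q (L ∘ v) ↔ w ∈ perturbedConeSet Q v := by
    have hli : LinearIndependent ℝ (L ∘ v) ↔ LinearIndependent ℝ v :=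
      LinearMap.linearIndependent_iff (L : E →ₗ[ℝ] E) L.ker
    refine and_congr hli ?_
    conv_rhs => rw [← hmap, Filter.eventually_map]
    exact Filter.eventually_congr (Filter.Eventually.of_forall hmem)
  rw [perturbedConeFun, perturbedConeFun]
  by_cases hw : w ∈ perturbedConeSet Q v
  · rw [Set.indicator_of_mem hw, Set.indicator_of_mem (hset.2 hw)]
  · rw [Set.indicator_of_notMem hw, Set.indicator_of_notMem (mt hset.1 hw)]

/-- A coordinate of positive vectors as a homomorphism. -/
def PosOrthant.coordHom {n : ℕ} (j : Fin n) : PosOrthant n →* ℝ where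
  toFun x := x.toVec j
  map_one' := rfl
  map_mul' _ _ := rfl

theorem log_toVec_prod_zpow {m : ℕ} (u : Fin m → PosOrthant (m + 1)) (z : Fin m → ℤ)
    (j : Fin (m + 1)) : Real.log ((∏ i, u i ^ z i : PosOrthant (m + 1)).toVec j) =
      ∑ i, z i * Real.log (u i j : ℝ) := by
  have h : (∏ i, u i ^ z i : PosOrthant (m + 1)).toVec j = ∏ i, (u i j : ℝ) ^ z i := by
    change PosOrthant.coordHom j _ = _
    simp only [map_prod, map_zpow]
    rfl
  rw [h, Real.log_prod fun i _ => (zpow_pos (u i j).2 _).ne']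
  simp [Real.log_zpow]

/-- The bridge from the group to the triangulation: translating the cone of `σ` by `u^z` gives the
cone over the Kuhn simplex at `z`. -/
theorem prod_zpow_kuhnVertex {m : ℕ} (u : Fin m → PosOrthant (m + 1)) (z : Fin m → ℤ)
    (σ : Equiv.Perm (Fin m)) (i : Fin (m + 1)) :
    ∏ p, u p ^ kuhnVertex z σ i p = (∏ p, u p ^ z p) * orderedProd u σ i := by
  have h : orderedProd u σ i = ∏ p, u p ^ (if (σ⁻¹ p).castSucc < i then 1 else 0 : ℤ) := by
    rw [← Equiv.prod_comp σ, orderedProd, Finset.prod_filter]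
    refine Finset.prod_congr rfl fun k _ => ?_
    by_cases hk : k.castSucc < i <;> simp [hk]
  rw [h, ← Finset.prod_mul_distrib]
  simp only [kuhnVertex, zpow_add]

/-- Componentwise multiplication by a positive vector as a linear automorphism. -/
def PosOrthant.mulEquiv {n : ℕ} (g : PosOrthant n) : (Fin n → ℝ) ≃ₗ[ℝ] (Fin n → ℝ) :=
  LinearEquiv.piCongrRight fun i => LinearEquiv.smulOfNeZero ℝ ℝ (g i : ℝ) (g i).2.ne'

theorem PosOrthant.mulEquiv_toVec {n : ℕ} (g x : PosOrthant n) :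
    g.mulEquiv x.toVec = (g * x).toVec := by
  ext i
  simp [PosOrthant.mulEquiv, PosOrthant.toVec]

theorem perturbedConeFun_mul {m : ℕ} {ι : Type*} [Fintype ι] (g x : PosOrthant (m + 1))
    (v : ι → PosOrthant (m + 1)) :
    perturbedConeFun (lastBasisVec m) (fun i => (g * v i).toVec) (g * x).toVec =
      perturbedConeFun (lastBasisVec m) (fun i => (v i).toVec) x.toVec := by
  rw [← perturbedConeFun_map g.mulEquiv (g (Fin.last m)).2 (Q := lastBasisVec m) ?_
    (fun i => (v i).toVec), PosOrthant.mulEquiv_toVec]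
  · congr 1
  · ext i
    by_cases hi : i = Fin.last m
    · subst hi
      simp [PosOrthant.mulEquiv, lastBasisVec]
    · simp [PosOrthant.mulEquiv, lastBasisVec, hi]

theorem sign_det_mul {n : ℕ} (g : PosOrthant n) (v : Fin n → PosOrthant n) :
    SignType.sign (Matrix.of fun i => (g * v i).toVec).det =
      SignType.sign (Matrix.of fun i => (v i).toVec).det := by
  have h : (Matrix.of fun i => (g * v i).toVec) =
      (Matrix.of fun i => (v i).toVec) * Matrix.diagonal g.toVec := by
    ext i j
    simp [PosOrthant.toVec, mul_comm]
  have hg : 0 < ∏ i, g.toVec i := Finset.prod_pos fun i _ => (g i).2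
  rw [h, Matrix.det_mul, Matrix.det_diagonal, sign_mul, sign_pos hg, mul_one]

theorem exists_zpow_equiv {m : ℕ} {G : Type*} [CommGroup G] {U : Subgroup G}
    (b : Module.Basis (Fin m) ℤ (Additive U)) {u : Fin m → G}
    (hu : ∀ i, u i = ((b i).toMul : G)) :
    ∃ e : (Fin m → ℤ) ≃ U, ∀ z, (e z : G) = ∏ i, u i ^ z i := by
  refine ⟨b.equivFun.symm.toEquiv.trans Additive.toMul, fun z => ?_⟩
  simp only [Equiv.trans_apply, LinearEquiv.coe_toEquiv, Module.Basis.equivFun_symm_apply,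
    toMul_sum, toMul_zsmul, hu]
  simp

/-! ### The logarithmic lattice, its orientation and the conclusion. -/

/-- The logarithms of a `ℤ`-basis of a discrete group are linearly independent over `ℝ`. -/
theorem linearIndependent_log {m : ℕ} {U : Subgroup (PosOrthant (m + 1))}
    (hdisc : DiscreteTopology U) {u : Fin m → PosOrthant (m + 1)} (hu : ∀ i, u i ∈ U)
    (hfree : ∀ z : Fin m → ℤ, ∏ i, u i ^ z i = 1 → z = 0) :
    LinearIndependent ℝ fun i j => Real.log (u i j : ℝ) := by
  set l : Fin m → Fin (m + 1) → ℝ := fun i j => Real.log (u i j : ℝ) with hl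
  let ex : (Fin (m + 1) → ℝ) → PosOrthant (m + 1) := fun v j => ⟨Real.exp (v j), Real.exp_pos _⟩
  have hex : ∀ v ∈ Submodule.span ℤ (Set.range l), ex v ∈ U := by
    intro v hv
    induction hv using Submodule.span_induction with
    | mem v hv =>
      obtain ⟨i, rfl⟩ := hv
      have : ex (l i) = u i := by
        ext j
        simp [ex, hl, Real.exp_log (u i j).2]
      rw [this]
      exact hu i
    | zero =>
      have : ex 0 = 1 := by
        ext j
        simp [ex]
      rw [this]
      exact U.one_mem
    | add v w _ _ hv hw =>
      have : ex (v + w) = ex v * ex w := by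
        ext j
        simp [ex, Real.exp_add]
      rw [this]
      exact U.mul_mem hv hw
    | smul k v _ hv =>
      have : ex (k • v) = ex v ^ k := by
        ext j
        simp [ex, ← Real.rpow_intCast, ← Real.exp_mul, mul_comm]
      rw [this]
      exact U.zpow_mem hv k
  -- Discreteness is pulled back from `U` along the continuous injective exponential; for a discrete
  -- subgroup the `ℤ`-rank equals the dimension of the real span.
  have hL : DiscreteTopology (Submodule.span ℤ (Set.range l)) := by
    let φ : Submodule.span ℤ (Set.range l) → U := fun v => ⟨ex v, hex v v.2⟩
    have hcont : Continuous φ := by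
      refine Continuous.subtype_mk (continuous_pi fun j => Continuous.subtype_mk ?_ _) _
      exact Real.continuous_exp.comp ((continuous_apply j).comp continuous_subtype_val)
    have hinj : Function.Injective φ := by
      intro v w hvw
      ext j
      have h1 := congrFun (congrArg Subtype.val hvw) j
      exact Real.exp_injective (congrArg Subtype.val h1)
    exact DiscreteTopology.of_continuous_injective hcont hinj
  have hZ : LinearIndependent ℤ l := by
    rw [Fintype.linearIndependent_iff]
    intro z hz
    have h1 : ∏ i, u i ^ z i = 1 := by
      ext j
      have h2 := log_toVec_prod_zpow u z j
      have h3 : ∑ i, (z i : ℝ) * Real.log (u i j : ℝ) = 0 := by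
        simpa [hl, Finset.sum_apply] using congrFun hz j
      rw [h3] at h2
      exact Real.eq_one_of_pos_of_log_eq_zero
        (((∏ i, u i ^ z i : PosOrthant (m + 1)) j).2) h2
    simp [hfree z h1]
  rw [linearIndependent_iff_card_eq_finrank_span, Real.finrank_eq_int_finrank_of_discrete hL]
  exact linearIndependent_iff_card_eq_finrank_span.1 hZ

/-- For a matrix whose rows sum to zero after adding a last column, subtracting that column from
the others does not change the sign of the determinant. -/
theorem sign_det_sub_last {m : ℕ} (l : Fin m → Fin (m + 1) → ℝ) (hl : ∀ i, ∑ j, l i j = 0) :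
    SignType.sign (Matrix.of fun i j : Fin m => l i j.castSucc - l i (Fin.last m)).det =
      SignType.sign (Matrix.of fun i j : Fin m => l i j.castSucc).det := by
  -- As `-l i (last)` is the sum of the other entries of the row, the subtraction is multiplication
  -- by `1 + J`, with `J` the all-ones matrix and determinant `1 + m > 0`.
  have h : (Matrix.of fun i j : Fin m => l i j.castSucc - l i (Fin.last m)) =
      (Matrix.of fun i j : Fin m => l i j.castSucc) *
        (1 + Matrix.replicateCol Unit (fun _ => (1 : ℝ)) *
          Matrix.replicateRow Unit fun _ => (1 : ℝ)) := by
    ext i j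
    have h1 := hl i
    rw [Fin.sum_univ_castSucc] at h1
    rw [Matrix.mul_add, Matrix.mul_one, Matrix.add_apply, Matrix.mul_apply]
    simp [Matrix.mul_apply]
    linarith
  rw [h, Matrix.det_mul, Matrix.det_one_add_replicateCol_mul_replicateRow, sign_mul]
  have : (fun _ : Fin m => (1 : ℝ)) ⬝ᵥ (fun _ => (1 : ℝ)) = m := by simp [dotProduct]
  have hpos : (0 : ℝ) < 1 + m := by positivity
  rw [this, sign_pos hpos, mul_one]

/-- A row relation of the difference matrix yields a combination of the `l i` with all coordinates
equal; they sum to zero, so the combination vanishes. -/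
theorem det_sub_last_ne_zero {m : ℕ} (l : Fin m → Fin (m + 1) → ℝ) (hl : ∀ i, ∑ j, l i j = 0)
    (hli : LinearIndependent ℝ l) :
    (Matrix.of fun i j : Fin m => l i j.castSucc - l i (Fin.last m)).det ≠ 0 := by
  intro hdet
  obtain ⟨c, hc0, hc⟩ := Matrix.exists_vecMul_eq_zero_iff.2 hdet
  refine hc0 (funext (Fintype.linearIndependent_iff.1 hli c ?_))
  have h1 : ∀ j : Fin m, ∑ i, c i * l i j.castSucc = ∑ i, c i * l i (Fin.last m) := by
    intro j
    have := congrFun hc j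
    simpa [Matrix.vecMul, dotProduct, mul_sub, sub_eq_zero] using this
  have h2 : ∑ j, ∑ i, c i * l i j = 0 := by
    rw [Finset.sum_comm]
    refine Finset.sum_eq_zero fun i _ => ?_
    rw [← Finset.mul_sum, hl, mul_zero]
  rw [Fin.sum_univ_castSucc, Finset.sum_congr rfl fun j _ => h1 j] at h2
  simp only [Finset.sum_const, Finset.card_univ, Fintype.card_fin, nsmul_eq_mul] at h2
  have h3 : ∑ i, c i * l i (Fin.last m) = 0 := by
    have h4 : ((m : ℝ) + 1) * ∑ i, c i * l i (Fin.last m) = 0 := by linarith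
    exact (mul_eq_zero.1 h4).resolve_left (by positivity)
  ext j
  induction j using Fin.lastCases with
  | last => simpa using h3
  | cast j => simpa using (h1 j).trans h3

/-- The degree theorem for the system of exponents of a discrete group of norm one vectors. -/
theorem finsum_coneWeight_mul_perturbedConeFun {m : ℕ} {U : Subgroup (PosOrthant (m + 1))}
    (hnorm : U ≤ normOne (m + 1)) (hdisc : DiscreteTopology U) {u : Fin m → PosOrthant (m + 1)}
    (hu : ∀ i, u i ∈ U) (e : (Fin m → ℤ) ≃ U)
    (he : ∀ z, (e z : PosOrthant (m + 1)) = ∏ i, u i ^ z i)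
    (hgen : ∀ s : Fin m → U, lastBasisVec m ∉
      Submodule.span ℝ (Set.range fun i => (s i : PosOrthant (m + 1)).toVec))
    (x : PosOrthant (m + 1)) :
    (Function.support fun g : U => ∑ σ : Equiv.Perm (Fin m), coneWeight u σ *
      perturbedConeFun (lastBasisVec m) (fun i => (orderedProd u σ i).toVec)
        ((g : PosOrthant (m + 1)) * x).toVec).Finite ∧
    ∑ᶠ g : U, ∑ σ : Equiv.Perm (Fin m), coneWeight u σ *
      perturbedConeFun (lastBasisVec m) (fun i => (orderedProd u σ i).toVec)
        ((g : PosOrthant (m + 1)) * x).toVec = 1 := by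
  set l : Fin m → Fin (m + 1) → ℝ := fun i j => Real.log (u i j : ℝ) with hl
  have hsum : ∀ i, ∑ j, l i j = 0 := by
    intro i
    have h1 : ∏ j, u i j = 1 := hnorm (hu i)
    let c : {y : ℝ // 0 < y} →* ℝ := ⟨⟨Subtype.val, rfl⟩, fun _ _ => rfl⟩
    have h2 : ∏ j, (u i j : ℝ) = 1 := by
      have h3 := congrArg c h1
      rw [map_prod, map_one] at h3
      exact h3
    rw [hl, ← Real.log_prod fun j _ => (u i j).2.ne', h2, Real.log_one]
  have hli : LinearIndependent ℝ l := by
    refine linearIndependent_log hdisc hu fun z hz => e.injective (Subtype.ext ?_)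
    rw [he, he, hz]
    simp
  set A : Matrix (Fin m) (Fin m) ℝ := Matrix.of fun i j => l i j.castSucc - l i (Fin.last m)
    with hA
  have hA0 : A.det ≠ 0 := det_sub_last_ne_zero l hsum hli
  have hsign : logOrientation u = (SignType.sign A.det : ℤ) := by
    rw [hA, sign_det_sub_last l hsum, logOrientation]
  set a : (Fin m → ℤ) → Fin (m + 1) → ℝ := fun z => (e z : PosOrthant (m + 1)).toVec with ha
  have hq : IsLogQuasilinear a A.transpose 0 := by
    refine ⟨fun z i => ((e z : PosOrthant (m + 1)) i).2, fun z j => ?_⟩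
    rw [abs_nonpos_iff, sub_eq_zero, logRatio, ha]
    simp only [he, log_toVec_prod_zpow]
    rw [← Finset.sum_sub_distrib]
    refine Finset.sum_congr rfl fun i _ => ?_
    simp [hA, hl]
    ring
  obtain ⟨hfin, hdeg⟩ := hq.finsum_perturbedConeFun (by rwa [Matrix.det_transpose])
    (fun t => hgen fun i => e (t i)) (x := x.toVec) fun j => (x j).2
  have hterm : ∀ z, ∑ σ : Equiv.Perm (Fin m), coneWeight u σ *
      perturbedConeFun (lastBasisVec m) (fun i => (orderedProd u σ i).toVec)
        ((((e z)⁻¹ : U) : PosOrthant (m + 1)) * x).toVec =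
      (-1) ^ m * logOrientation u * ∑ σ : Equiv.Perm (Fin m), (Equiv.Perm.sign σ : ℤ) *
        ((SignType.sign (Matrix.of fun i => a (kuhnVertex z σ i)).det : ℤ) *
          perturbedConeFun (lastBasisVec m) (fun i => a (kuhnVertex z σ i)) x.toVec) := by
    intro z
    rw [Finset.mul_sum]
    refine Finset.sum_congr rfl fun σ _ => ?_
    have h1 : ∀ i, a (kuhnVertex z σ i) =
        ((e z : PosOrthant (m + 1)) * orderedProd u σ i).toVec := by
      intro i
      rw [ha]
      simp only [he, prod_zpow_kuhnVertex]
    have h2 := perturbedConeFun_mul (e z : PosOrthant (m + 1))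
      ((((e z)⁻¹ : U) : PosOrthant (m + 1)) * x) (orderedProd u σ)
    rw [Subgroup.coe_inv, mul_inv_cancel_left] at h2
    simp only [h1, sign_det_mul]
    rw [Subgroup.coe_inv, ← h2, coneWeight]
    ring
  -- The inverse appears because testing `g * x` against a fixed cone is testing `x` against the
  -- cone translated by `g⁻¹`.
  let φ : (Fin m → ℤ) ≃ U := e.trans (Equiv.inv U)
  constructor
  · refine (hfin.image φ).subset fun g hg => ⟨φ.symm g, fun h0 => hg ?_, φ.apply_symm_apply g⟩
    have h1 := hterm (φ.symm g)
    beta_reduce at h0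
    rw [h0, mul_zero] at h1
    have h2 : (e (φ.symm g))⁻¹ = g := φ.apply_symm_apply g
    rwa [h2] at h1
  · rw [← finsum_comp_equiv φ]
    refine (finsum_congr hterm).trans ?_
    rw [← mul_finsum, hdeg, hsign, Matrix.det_transpose]
    have h3 : ((-1 : ℤ)) ^ m * (-1) ^ m = 1 := by
      rw [← mul_pow]; simp
    have h4 : (SignType.sign A.det : ℤ) * (SignType.sign A.det : ℤ) = 1 := by
      rcases lt_or_gt_of_ne hA0 with h | h
      · simp [sign_neg h]
      · simp [sign_pos h]
    linear_combination (SignType.sign A.det : ℤ) * (SignType.sign A.det : ℤ) * h3 + h4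

end

/-- The dimension `n ≥ 1` is written `m + 1`, so that `m = n - 1` is the rank of `U`. The family `b`
is an arbitrary ordered `ℤ`-basis of the free abelian group `U`. -/
theorem theorem1p3 (m : ℕ) (U : Subgroup (PosOrthant (m + 1)))
    (hnorm : U ≤ normOne (m + 1)) (hdisc : DiscreteTopology U)
    (b : Module.Basis (Fin m) ℤ (Additive U))
    (u : Fin m → PosOrthant (m + 1))
    (hu : ∀ i, u i = ((b i).toMul : PosOrthant (m + 1)))
    (hgen : ∀ s : Fin m → U,
      lastBasisVec m ∉
        Submodule.span ℝ (Set.range fun i => (s i : PosOrthant (m + 1)).toVec)) :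
    IsSignedFundamentalDomain U
      (∑ σ : Equiv.Perm (Fin m), coneWeight u σ •
        perturbedCone (lastBasisVec m) fun i => (orderedProd u σ i).toVec) ∧
    ∀ x : PosOrthant (m + 1),
      (Function.support fun g : U => ∑ σ : Equiv.Perm (Fin m), coneWeight u σ *
        perturbedConeFun (lastBasisVec m) (fun i => (orderedProd u σ i).toVec)
          ((g : PosOrthant (m + 1)) * x).toVec).Finite ∧
      ∑ᶠ g : U, ∑ σ : Equiv.Perm (Fin m), coneWeight u σ *
        perturbedConeFun (lastBasisVec m) (fun i => (orderedProd u σ i).toVec)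
          ((g : PosOrthant (m + 1)) * x).toVec = 1 := by
  have hu' : ∀ i, u i ∈ U := fun i => by
    rw [hu]
    exact (b i).toMul.2
  obtain ⟨e, he⟩ := exists_zpow_equiv b hu
  have key := finsum_coneWeight_mul_perturbedConeFun hnorm hdisc hu' e he hgen
  have hchar : ∀ w : Fin (m + 1) → ℝ, FormalConeSum.charFun
      (∑ σ : Equiv.Perm (Fin m), coneWeight u σ •
        perturbedCone (lastBasisVec m) fun i => (orderedProd u σ i).toVec) w =
      ∑ σ : Equiv.Perm (Fin m), coneWeight u σ *
        perturbedConeFun (lastBasisVec m) (fun i => (orderedProd u σ i).toVec) w := by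
    intro w
    rw [FormalConeSum.charFun_sum_smul]
    refine Finset.sum_congr rfl fun σ _ => ?_
    rw [charFun_perturbedCone]
    intro hv
    -- With `m + 1` independent vectors the cone is full-dimensional, so `e_n` lies in their span.
    rw [hv.span_eq_top_of_card_eq_finrank (by simp)]
    exact Submodule.mem_top
  refine ⟨fun x => ?_, key⟩
  simp only [hchar]
  exact key x
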